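/- **Setting.** For $n\ge 1$ let $\varphi_n:\mathbb R^n\to\mathbb R$ be convex and even with $e^{-\varphi_n}\in L^1(\mathbb R^n)$, let $X_n$ be a random vector with density proportional to $e^{-\varphi_n}$, and assume $\mathbb E\|X_n\|_2^2<\infty$ and $\mathbb E\|\nabla\varphi_n(X_n)\|_2^2<\infty$. Assume that the Fisher information matrix $\mathcal I_n=\mathbb E[\nabla\varphi_n(X_n)\nabla\varphi_n(X_n)^T]$ is the identity. For $v\in\mathbb R^n$ put $P_v^{\varphi_n}(x)=\varphi_n(x+v)-\varphi_n(x)-\tfrac12 v^T\mathcal I_n v$. Let $\sigma_n$ be the uniform probability measure on the unit sphere $S^{n-1}$, and let $\mathrm{KS}$ be the Kolmogorov–Smirnov distance (sup distance of CDFs). Assume: - (D1) there are $b_n\to0$ and measurable $\Omega_n\subseteq S^{n-1}$ with $\sigma_n(\Omega_n)\ge 1-b_n$ such that $\mathrm{KS}\big(P_v^{\varphi_n}(X_n),\,v^T\nabla\varphi_n(X_n)\big)\le b_n$ for all $v\in\Omega_n$; - (D2) $\|\nabla\varphi_n(X_n)\|_2/\sqrt n\to1$ in probability. For probability measures $P,Q$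 and $\alpha\in[0,1]$ let $T[P,Q](\alpha)=\inf\{1-Q(A): A \text{ measurable},\ P(A)\le\alpha\}$ be the trade-off (ROC) function, and $G_1=T[N(0,1),N(1,1)]$. A query is a map $f:\mathcal X^k\to\mathbb R^n$; two datasets in $\mathcal X^k$ are neighboring if they differ in exactly one entry; $f$ has $\ell_2$-sensitivity $1$ if $\sup\|f(D')-f(D)\|_2=1$ over neighboring $D,D'$. The noise-addition mechanism is $M_n(D)=f(D)+X_n$, and $T[M_n(D),M_n(D')]$ refers to the laws of the outputs. For $E\subseteq S^{n-1}$, call neighboring $D,D'$ *neighboring along $E$* if $f(D')\ne f(D)$ and $\frac{f(D')-f(D)}{\|f(D')-f(D)\|_2}\in E$. **Theorem.** There are positive numbers $c_n\to0$ and measurable sets $E_n\subseteq S^{n-1}$ with $\sigma_n(E_n)>1-c_n$, depending only on the sequence $(\varphi_n)$, such that for every $n\ge1$ and every query $f:\mathcal X^k\to\mathbb R^n$ (any $\mathcal X$, $k$) of $\ell_2$-sensitivity $1$: 1. $T[M_n(D),M_n(D')](\alpha)\ge G_1(\alpha)-c_n$ for all $D,D'$ neighboring along $E_n$ and all $\alpha\in[0,1]$;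 2. if the sensitivity of $f$ is still $1$ along $E_n$, i.e. $\sup\|f(D')-f(D)\|_2=1$ over $D,D'$ neighboring along $E_n$ (for instance, if $E_n\neq\emptyset$ and every unit vector is a difference $f(D')-f(D)$ of neighboring datasets), then $$\Big\|\inf_{D,D'}T[M_n(D),M_n(D')]-G_1\Big\|_\infty\le c_n,$$ where the pointwise infimum is over all $D,D'$ neighboring along $E_n$ and $\|\cdot\|_\infty$ is the sup norm on $[0,1]$. -/

import Mathlib

open MeasureTheory ProbabilityTheory Filter Topology Set

noncomputable section

namespace PrivacyCLT

/-- Euclidean space of dimension `n`. -/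
abbrev Euc (n : ℕ) : Type := EuclideanSpace ℝ (Fin n)

/-- The unit sphere of `ℝⁿ`. -/
abbrev UnitSphere (n : ℕ) : Type := Metric.sphere (0 : Euc n) 1

/-- The uniform probability measure on the unit sphere: normalized surface measure. -/
def sphereUniform (n : ℕ) : Measure (UnitSphere n) :=
  ((volume : Measure (Euc n)).toSphere univ)⁻¹ • (volume : Measure (Euc n)).toSphere

/-! ### Log-concave noise -/

/-- The law of the random vector `X_φ`, with density proportional to `exp (-φ)`. -/
def noiseLaw {n : ℕ} (φ : Euc n → ℝ) : Measure (Euc n) :=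
  (volume : Measure (Euc n)).tilted (fun x => -φ x)

/-- The class of potentials: even convex functions `φ` with `exp (-φ)` integrable,
`E ‖X_φ‖² < ∞` and `E ‖∇φ(X_φ)‖² < ∞`. (A convex function is differentiable almost everywhere,
so the value of `gradient φ` at the other points is irrelevant.) -/
structure IsPotential {n : ℕ} (φ : Euc n → ℝ) : Prop where
  convex : ConvexOn ℝ univ φ
  even : ∀ x, φ (-x) = φ x
  integrable_exp : Integrable (fun x => Real.exp (-φ x)) volume
  second_moment : Integrable (fun x => ‖x‖ ^ 2) (noiseLaw φ)
  fisher_finite : Integrable (fun x => ‖gradient φ x‖ ^ 2) (noiseLaw φ)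

/-- The Fisher information matrix `E [∇φ(X_φ) ∇φ(X_φ)ᵀ]`. -/
def fisherInfo {n : ℕ} (φ : Euc n → ℝ) : Matrix (Fin n) (Fin n) ℝ :=
  Matrix.of fun i j => ∫ x, gradient φ x i * gradient φ x j ∂(noiseLaw φ)

/-- The likelihood projection `P_v^φ(x) = φ(x + v) - φ(x) - ½ vᵀ I_φ v`. -/
def likelihoodProj {n : ℕ} (φ : Euc n → ℝ) (v x : Euc n) : ℝ :=
  φ (x + v) - φ x - 1 / 2 * dotProduct v.ofLp ((fisherInfo φ).mulVec v.ofLp)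

/-- Kolmogorov-Smirnov distance of two probability measures on `ℝ`. -/
def ksDist (μ ν : Measure ℝ) : ℝ := ⨆ t : ℝ, |cdf μ t - cdf ν t|

/-- Condition (D1): the Kolmogorov-Smirnov distance between `P_v^{φ_n}(X_n)` and `vᵀ ∇φ_n(X_n)` is
`o(1)` with probability at least `1 - o(1)` over uniform `v` in the unit sphere. -/
def CondD1 (φ : ∀ n : ℕ, Euc n → ℝ) : Prop :=
  ∃ (b : ℕ → ℝ) (Ω : ∀ n : ℕ, Set (UnitSphere n)), Tendsto b atTop (𝓝 0) ∧
    ∀ n : ℕ, 1 ≤ n → MeasurableSet (Ω n) ∧ 1 - b n ≤ (sphereUniform n).real (Ω n) ∧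
      ∀ v ∈ Ω n,
        ksDist ((noiseLaw (φ n)).map (likelihoodProj (φ n) (v : Euc n)))
          ((noiseLaw (φ n)).map (fun x => inner ℝ (v : Euc n) (gradient (φ n) x))) ≤ b n

/-- Condition (D2): `‖∇φ_n(X_n)‖ = √n (1 + o_P(1))`. -/
def CondD2 (φ : ∀ n : ℕ, Euc n → ℝ) : Prop :=
  ∀ ε : ℝ, 0 < ε → Tendsto (fun n : ℕ =>
    (noiseLaw (φ n)).real {x | ε ≤ |‖gradient (φ n) x‖ / √(n : ℝ) - 1|}) atTop (𝓝 0)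

/-! ### ROC (trade-off) functions -/

/-- The ROC (trade-off) function `T[P, Q](α)`: the least type II error `1 - Q(A)` of a test of `P`
against `Q`, with rejection region `A`, whose type I error `P(A)` is at most `α`. -/
def roc {Ω : Type*} [MeasurableSpace Ω] (P Q : Measure Ω) (α : ℝ) : ℝ :=
  sInf {β : ℝ | ∃ A : Set Ω, MeasurableSet A ∧ P.real A ≤ α ∧ β = 1 - Q.real A}

/-- `G_μ = T[N(0,1), N(μ,1)]`. -/
def gaussianRoc (μ : ℝ) (α : ℝ) : ℝ := roc (gaussianReal 0 1) (gaussianReal μ 1) α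

/-! ### Queries and mechanisms -/

/-- Two datasets of `k` people are neighboring if they differ in exactly one individual. -/
def Neighboring {𝒳 : Type*} {k : ℕ} (D D' : Fin k → 𝒳) : Prop := ∃! i, D i ≠ D' i

/-- The `ℓ₂`-sensitivity of `f` is `s`. -/
def HasSensitivity {𝒳 : Type*} {k n : ℕ} (f : (Fin k → 𝒳) → Euc n) (s : ℝ) : Prop :=
  IsLUB {r : ℝ | ∃ D D', Neighboring D D' ∧ r = ‖f D' - f D‖} s

/-- `D, D'` are neighboring and the direction `(f D' - f D) / ‖f D' - f D‖` lies in `E`.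
(If `f D' = f D`, the normalized vector is `0`, which is not in the sphere.) -/
def NeighboringAlong {𝒳 : Type*} {k n : ℕ} (f : (Fin k → 𝒳) → Euc n) (E : Set (UnitSphere n))
    (D D' : Fin k → 𝒳) : Prop :=
  Neighboring D D' ∧ ∃ v ∈ E, (v : Euc n) = ‖f D' - f D‖⁻¹ • (f D' - f D)

/-- The `ℓ₂`-sensitivity of `f` along the set of directions `E` is `s`. -/
def HasSensitivityAlong {𝒳 : Type*} {k n : ℕ} (f : (Fin k → 𝒳) → Euc n) (E : Set (UnitSphere n))
    (s : ℝ) : Prop :=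
  IsLUB {r : ℝ | ∃ D D', NeighboringAlong f E D D' ∧ r = ‖f D' - f D‖} s

/-- The law of the output `M(D) = f(D) + X_φ` of the noise-addition mechanism. -/
def mechanism {𝒳 : Type*} {k n : ℕ} (φ : Euc n → ℝ) (f : (Fin k → 𝒳) → Euc n)
    (D : Fin k → 𝒳) : Measure (Euc n) :=
  (noiseLaw φ).map (fun x => f D + x)

/-- The pointwise infimum of `T[M(D), M(D')]` over neighboring `D, D'` with direction in `E`. -/
def infRoc {𝒳 : Type*} {k n : ℕ} (φ : Euc n → ℝ) (f : (Fin k → 𝒳) → Euc n)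
    (E : Set (UnitSphere n)) (α : ℝ) : ℝ :=
  sInf {β : ℝ | ∃ D D', NeighboringAlong f E D D' ∧
    β = roc (mechanism φ f D) (mechanism φ f D') α}

end PrivacyCLT

end

/-!
Write `P` for the noise law, `w = f D' - f D`, and `Q_w` for the translate of `P` by `w`; after a
translation the trade-off function of the mechanism at `D, D'` is `T[P, Q_w]`.

*Reduction to unit translations.* By convexity of `φ`, the likelihood ratio test of `P` against
`Q_{s v}` with `0 ≤ s ≤ 1` is an upper set in the direction `v`, so that it is at least as powerful
against `Q_v`. Together with the weighted Neyman-Pearson lemma this bounds every test of `P` against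
`Q_{s v}` by the likelihood ratio tests of `P` against `Q_v` (`IsPotential.map_add_smul_sub_le`).
The power and the level of the latter are read off from the law of the single variable
`φ (X + v) - φ X`, by evenness of `φ`. If this law is close to `N(1/2, 1)` in Kolmogorov-Smirnov
distance, the trade-off function is close to that of `N(0,1)` and `N(1,1)`, because the latter is
uniformly continuous (`gaussianRoc_modulus`). The infimum over datasets sees translations of length
close to `1` only; total variation continuity of translations passes from these to length `1`.

*Normality of the log-likelihood ratio.* By (D1) it suffices that `⟪v, ∇φ X⟫` is nearly standard
normal for most directions `v`. Let `Z` be a standard Gaussian vector, so that `Z / ‖Z‖` is uniform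
on the sphere, and let `X, X'` be independent copies of the noise. Given `X, X'`, the pair
`(⟪Z, ∇φ X⟫, ⟪Z, ∇φ X'⟫) / √n` is Gaussian. By (D2) its variances tend to `1`; its covariance tends
to `0` since `E ⟪∇φ X, ∇φ X'⟫² = tr I² = n`; and `‖Z‖ / √n → 1`. By Lévy's continuity theorem the
pair `(⟪Z, ∇φ X⟫, ⟪Z, ∇φ X'⟫) / ‖Z‖` is asymptotically a pair of independent standard normal
variables (`tendsto_charFun_projPair` is the corresponding statement on characteristic functions).
This computes the first two moments, over the direction, of the distribution function of
`⟪v, ∇φ X⟫` at a given point: its variance tends to `0`, and Chebyshev's inequality applies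
(`tendstoInProb_measureReal_inner_le`). Finitely many points suffice for uniform closeness.
-/

noncomputable section

namespace PrivacyCLT

/-! ### Trade-off functions and the Neyman-Pearson lemma -/

lemma roc_le {Ω : Type*} [MeasurableSpace Ω] {P Q : Measure Ω} [IsProbabilityMeasure Q] {α : ℝ}
    {A : Set Ω} (hA : MeasurableSet A) (hα : P.real A ≤ α) : roc P Q α ≤ 1 - Q.real A :=
  csInf_le ⟨0, by rintro _ ⟨B, -, -, rfl⟩; linarith [measureReal_le_one (μ := Q) (s := B)]⟩
    ⟨A, hA, hα, rfl⟩

lemma le_roc {Ω : Type*} [MeasurableSpace Ω] {P Q : Measure Ω} {α b : ℝ} (hα : 0 ≤ α)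
    (h : ∀ A, MeasurableSet A → P.real A ≤ α → b ≤ 1 - Q.real A) : b ≤ roc P Q α := by
  refine le_csInf ⟨_, ∅, .empty, by simpa using hα, rfl⟩ ?_
  rintro _ ⟨A, hA, hα, rfl⟩
  exact h A hA hα

lemma roc_nonneg {Ω : Type*} [MeasurableSpace Ω] {P Q : Measure Ω} [IsProbabilityMeasure Q]
    {α : ℝ} (hα : 0 ≤ α) : 0 ≤ roc P Q α :=
  le_roc hα fun A _ _ => by linarith [measureReal_le_one (μ := Q) (s := A)]

lemma roc_le_one {Ω : Type*} [MeasurableSpace Ω] {P Q : Measure Ω} [IsProbabilityMeasure Q]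
    {α : ℝ} (hα : 0 ≤ α) : roc P Q α ≤ 1 := by
  simpa using roc_le (P := P) (Q := Q) .empty (by simpa using hα)

/-- The weighted form of the Neyman-Pearson lemma: among all tests `A`, the likelihood ratio test
`{K p ≤ q}` maximizes `Q(A) - K P(A)`. -/
lemma sub_mul_le_of_density {Ω : Type*} [MeasurableSpace Ω] {ν P Q : Measure Ω} {p q : Ω → ℝ}
    (hpm : StronglyMeasurable p) (hqm : StronglyMeasurable q)
    (hpi : Integrable p ν) (hqi : Integrable q ν)
    (hp : ∀ A, MeasurableSet A → P.real A = ∫ x in A, p x ∂ν)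
    (hq : ∀ A, MeasurableSet A → Q.real A = ∫ x in A, q x ∂ν) (K : ℝ) {A : Set Ω}
    (hA : MeasurableSet A) :
    Q.real A - K * P.real A ≤ Q.real {x | K * p x ≤ q x} - K * P.real {x | K * p x ≤ q x} := by
  have hB : MeasurableSet {x | K * p x ≤ q x} :=
    measurableSet_le (hpm.measurable.const_mul K) hqm.measurable
  have key := setIntegral_le_nonneg hA (f := fun x => q x - K * p x)
    (hqm.sub (hpm.const_mul K)) (hqi.sub (hpi.const_mul K))
  simp only [sub_nonneg] at key
  rw [integral_sub hqi.integrableOn (hpi.const_mul K).integrableOn, integral_const_mul,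
    integral_sub hqi.integrableOn (hpi.const_mul K).integrableOn, integral_const_mul] at key
  rwa [hp A hA, hq A hA, hp _ hB, hq _ hB]

/-! ### The Gaussian trade-off function -/

/-- The cumulative distribution function `Φ` of the standard normal law. -/
def normalCDF (t : ℝ) : ℝ := (gaussianReal 0 1).real (Iic t)

instance : NullSingletonClass (gaussianReal 0 1) := nullSingletonClass_gaussianReal one_ne_zero
instance : NullSingletonClass (gaussianReal 1 1) := nullSingletonClass_gaussianReal one_ne_zero

lemma normalCDF_mono : Monotone normalCDF := fun _ _ h => measureReal_mono (Iic_subset_Iic.2 h)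

lemma normalCDF_nonneg (t : ℝ) : 0 ≤ normalCDF t := measureReal_nonneg

lemma normalCDF_le_one (t : ℝ) : normalCDF t ≤ 1 := measureReal_le_one

lemma continuous_measureReal_inter_Iic {μ : Measure ℝ} [IsProbabilityMeasure μ] [NullSingletonClass μ]
    (A : Set ℝ) : Continuous fun s => μ.real (A ∩ Iic s) := by
  rw [continuous_iff_continuousAt]
  intro s
  have h1 : ContinuousAt (fun s => μ (A ∩ Iic s)) s := by
    have hm : Monotone fun s => μ (A ∩ Iic s) :=
      fun a b h => measure_mono (inter_subset_inter_right _ (Iic_subset_Iic.2 h))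
    rw [continuousAt_iff_continuous_left_right]
    constructor
    · rw [← continuousWithinAt_Iio_iff_Iic, hm.continuousWithinAt_Iio_iff_leftLim_eq]
      apply le_antisymm (hm.leftLim_le le_rfl)
      have : μ (A ∩ Iic s) = μ (A ∩ Iio s) := by
        apply measure_congr
        exact (ae_eq_refl A).inter (Iio_ae_eq_Iic (μ := μ)).symm
      rw [this]
      obtain ⟨u, hu, hus, hlim⟩ := exists_seq_strictMono_tendsto s
      have hU : A ∩ Iio s = ⋃ n, A ∩ Iic (u n) := by
        rw [← inter_iUnion, iUnion_Iic_eq_Iio_of_lt_of_tendsto hus hlim]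
      rw [hU]
      have hmono : Monotone fun n => A ∩ Iic (u n) :=
        fun a b h => inter_subset_inter_right _ (Iic_subset_Iic.2 (hu.monotone h))
      rw [hmono.measure_iUnion]
      exact iSup_le fun n => hm.le_leftLim (hus n)
    · rw [← continuousWithinAt_Ioi_iff_Ici]
      have : (fun s => μ (A ∩ Iic s)) = fun s => (μ.restrict A) (Iic s) := by
        ext s; rw [Measure.restrict_apply measurableSet_Iic, inter_comm]
      rw [this, ContinuousWithinAt]
      obtain ⟨u, hu, hus, hlim⟩ := exists_seq_strictAnti_tendsto s
      have hm' : Monotone fun s => (μ.restrict A) (Iic s) := fun a b h =>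
        measure_mono (Iic_subset_Iic.2 h)
      have := tendsto_measure_biInter_gt (μ := μ.restrict A) (s := fun r => Iic r) (a := s)
        (fun r _ => measurableSet_Iic.nullMeasurableSet) (fun i j _ h => Iic_subset_Iic.2 h)
        ⟨s + 1, by simp, measure_ne_top _ _⟩
      convert! this using 3
      ext x
      simp only [mem_Iic, mem_iInter]
      exact ⟨fun h r hr => h.trans hr.le, fun h => le_of_forall_gt_imp_ge_of_dense h⟩
  exact (ENNReal.tendsto_toReal (measure_ne_top _ _)).comp h1

lemma continuous_normalCDF : Continuous normalCDF := by
  have := continuous_measureReal_inter_Iic (μ := gaussianReal 0 1) univ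
  simp only [univ_inter] at this
  exact this

lemma tendsto_normalCDF_atTop : Tendsto normalCDF atTop (𝓝 1) :=
  (tendsto_cdf_atTop (gaussianReal 0 1)).congr fun t => cdf_eq_real _ t

lemma tendsto_normalCDF_atBot : Tendsto normalCDF atBot (𝓝 0) :=
  (tendsto_cdf_atBot (gaussianReal 0 1)).congr fun t => cdf_eq_real _ t

lemma exists_normalCDF_eq {p : ℝ} (h0 : 0 < p) (h1 : p < 1) : ∃ t, normalCDF t = p :=
  mem_range_of_exists_le_of_exists_ge continuous_normalCDF
    ((tendsto_normalCDF_atBot.eventually_lt_const h0).exists.imp fun _ h => h.le)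
    ((tendsto_normalCDF_atTop.eventually_const_lt h1).exists.imp fun _ h => h.le)

lemma measureReal_Iic_gaussianReal (m t : ℝ) :
    (gaussianReal m 1).real (Iic t) = normalCDF (t - m) := by
  have h := gaussianReal_map_add_const (μ := 0) (v := 1) m
  rw [zero_add] at h
  rw [← h, map_measureReal_apply (by fun_prop) measurableSet_Iic, normalCDF]
  congr 1
  ext x
  simp [le_sub_iff_add_le]

lemma measureReal_Ici_gaussianReal (m : ℝ) [NullSingletonClass (gaussianReal m 1)] (t : ℝ) :
    (gaussianReal m 1).real (Ici t) = 1 - normalCDF (t - m) := by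
  rw [← measureReal_Iic_gaussianReal, ← measureReal_congr (Iio_ae_eq_Iic (a := t)), ← compl_Iio,
    probReal_compl_eq_one_sub measurableSet_Iio]

lemma normalCDF_neg (t : ℝ) : normalCDF (-t) = 1 - normalCDF t := by
  have h := gaussianReal_map_neg (μ := 0) (v := 1)
  rw [neg_zero] at h
  have h2 := measureReal_Ici_gaussianReal 0 t
  rw [sub_zero] at h2
  rw [← h2, normalCDF]
  nth_rw 1 [← h]
  rw [map_measureReal_apply (by fun_prop) measurableSet_Iic]
  congr 1
  ext x
  simp

lemma measureReal_gaussianReal_eq_integral (m : ℝ) (A : Set ℝ) :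
    (gaussianReal m 1).real A = ∫ x in A, gaussianPDFReal m 1 x := by
  rw [measureReal_def, gaussianReal_apply_eq_integral _ one_ne_zero,
    ENNReal.toReal_ofReal (integral_nonneg fun x => gaussianPDFReal_nonneg _ _ _)]

/-- The weighted Neyman-Pearson inequality for `N(0,1)` against `N(1,1)`, whose likelihood ratio
`exp (x - 1/2)` is increasing. -/
lemma gaussian_sub_mul_le (a : ℝ) {A : Set ℝ} (hA : MeasurableSet A) :
    (gaussianReal 1 1).real A - Real.exp (a - 1 / 2) * (gaussianReal 0 1).real A ≤
      normalCDF (1 - a) - Real.exp (a - 1 / 2) * normalCDF (-a) := by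
  have h := sub_mul_le_of_density (P := gaussianReal 0 1) (Q := gaussianReal 1 1)
    (stronglyMeasurable_gaussianPDFReal 0 1) (stronglyMeasurable_gaussianPDFReal 1 1)
    (integrable_gaussianPDFReal 0 1) (integrable_gaussianPDFReal 1 1)
    (fun A _ => measureReal_gaussianReal_eq_integral 0 A)
    (fun A _ => measureReal_gaussianReal_eq_integral 1 A) (Real.exp (a - 1 / 2)) hA
  have hB : {x | Real.exp (a - 1 / 2) * gaussianPDFReal 0 1 x ≤ gaussianPDFReal 1 1 x} = Ici a := by
    ext x
    have hpos : (0 : ℝ) < (√(2 * Real.pi * 1))⁻¹ := by positivity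
    simp only [gaussianPDFReal, mem_ofPred_eq, mem_Ici, NNReal.coe_one]
    rw [mul_left_comm, mul_le_mul_iff_right₀ hpos, ← Real.exp_add, Real.exp_le_exp]
    constructor <;> intro h <;> nlinarith
  rw [hB, measureReal_Ici_gaussianReal, measureReal_Ici_gaussianReal] at h
  rw [normalCDF_neg, show 1 - a = -(a - 1) by ring, normalCDF_neg]
  simpa using h

/-- Neyman-Pearson for `N(0,1)` against `N(1,1)`. -/
lemma gaussian_le_of_le {a : ℝ} {A : Set ℝ} (hA : MeasurableSet A)
    (h : (gaussianReal 0 1).real A ≤ normalCDF (-a)) :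
    (gaussianReal 1 1).real A ≤ normalCDF (1 - a) := by
  have := gaussian_sub_mul_le a hA
  nlinarith [Real.exp_pos (a - 1 / 2)]

lemma gaussian_absolutelyContinuous_modulus {η : ℝ} (hη : 0 < η) :
    ∃ δ > 0, ∀ A, MeasurableSet A → (gaussianReal 0 1).real A ≤ δ →
      (gaussianReal 1 1).real A ≤ η := by
  have ht : Tendsto (fun a : ℝ => normalCDF (1 - a)) atTop (𝓝 0) :=
    tendsto_normalCDF_atBot.comp (tendsto_atBot_add_const_left _ 1 tendsto_neg_atTop_atBot)
  obtain ⟨a, ha⟩ := (ht.eventually_lt_const (half_pos hη)).exists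
  have hK := Real.exp_pos (a - 1 / 2)
  refine ⟨η / 2 / Real.exp (a - 1 / 2), by positivity, fun A hA h => ?_⟩
  have h1 := gaussian_sub_mul_le a hA
  rw [le_div_iff₀ hK] at h
  nlinarith [mul_nonneg hK.le (normalCDF_nonneg (-a))]

/-- Uniform continuity of the Gaussian trade-off function: a test of level `β` is cut down to a
test of level `α` by intersecting it with a half-line. -/
lemma gaussianRoc_modulus {η : ℝ} (hη : 0 < η) :
    ∃ δ > 0, ∀ α β : ℝ, 0 ≤ α → α ≤ β → β ≤ α + δ →
      gaussianRoc 1 α ≤ gaussianRoc 1 β + η := by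
  obtain ⟨δ, hδ, H⟩ := gaussian_absolutelyContinuous_modulus hη
  refine ⟨δ, hδ, fun α β hα hαβ hβ => ?_⟩
  rw [← sub_le_iff_le_add]
  refine le_roc (hα.trans hαβ) fun A hA hAβ => ?_
  obtain ⟨A', hA'm, hA'A, hA'α, hdiff⟩ : ∃ A', MeasurableSet A' ∧ A' ⊆ A ∧
      (gaussianReal 0 1).real A' ≤ α ∧ (gaussianReal 0 1).real (A \ A') ≤ δ := by
    rcases le_or_gt ((gaussianReal 0 1).real A) α with hle | hlt
    · exact ⟨A, hA, subset_rfl, hle, by simpa using hδ.le⟩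
    rcases hα.eq_or_lt with rfl | hα
    · exact ⟨∅, .empty, by simp, by simp, by simpa using hAβ.trans (by simpa using hβ)⟩
    have hbot : ∃ s, (gaussianReal 0 1).real (A ∩ Iic s) ≤ α := by
      obtain ⟨s, hs⟩ := (tendsto_normalCDF_atBot.eventually_lt_const hα).exists
      exact ⟨s, (measureReal_mono inter_subset_right).trans hs.le⟩
    have htop : ∃ s, α ≤ (gaussianReal 0 1).real (A ∩ Iic s) := by
      obtain ⟨s, hs⟩ := (tendsto_normalCDF_atTop.eventually_const_lt
        (sub_lt_self 1 (sub_pos.2 hlt))).exists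
      refine ⟨s, ?_⟩
      have h1 := measureReal_inter_add_sdiff (μ := gaussianReal 0 1) (s := A) (measurableSet_Iic (a := s))
      have h2 : (gaussianReal 0 1).real (A \ Iic s) ≤ 1 - normalCDF s := by
        rw [normalCDF, ← probReal_compl_eq_one_sub measurableSet_Iic]
        exact measureReal_mono fun x hx => hx.2
      linarith
    obtain ⟨s, hs⟩ := mem_range_of_exists_le_of_exists_ge
      (continuous_measureReal_inter_Iic (μ := gaussianReal 0 1) A) hbot htop
    refine ⟨A ∩ Iic s, hA.inter measurableSet_Iic, inter_subset_left, hs.le, ?_⟩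
    rw [measureReal_sdiff inter_subset_left (hA.inter measurableSet_Iic)]
    linarith
  have h1 := H _ (hA.diff hA'm) hdiff
  rw [measureReal_sdiff hA'A hA'm] at h1
  have h2 : gaussianRoc 1 α ≤ _ := roc_le (Q := gaussianReal 1 1) hA'm hA'α
  linarith

lemma gaussianRoc_le {α a : ℝ} (h : normalCDF (-a) ≤ α) :
    gaussianRoc 1 α ≤ 1 - normalCDF (1 - a) := by
  have h1 := measureReal_Ici_gaussianReal 0 a
  have h2 := measureReal_Ici_gaussianReal 1 a
  rw [sub_zero, ← normalCDF_neg] at h1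
  rw [← normalCDF_neg, neg_sub] at h2
  rw [← h2]
  exact roc_le measurableSet_Ici (h1.trans_le h)

lemma le_gaussianRoc {α a : ℝ} (hα : 0 ≤ α) (h : α ≤ normalCDF (-a)) :
    1 - normalCDF (1 - a) ≤ gaussianRoc 1 α :=
  le_roc hα fun _ hA hAα => sub_le_sub_left (gaussian_le_of_le hA (hAα.trans h)) 1

lemma gaussianRoc_zero : gaussianRoc 1 0 = 1 := by
  refine le_antisymm (roc_le_one le_rfl) (le_roc le_rfl fun A _ h => ?_)
  have h0 : gaussianReal 0 1 A = 0 := (measureReal_eq_zero_iff (measure_ne_top _ _)).1 (le_antisymm h measureReal_nonneg)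
  have h1 : gaussianReal 1 1 A = 0 := (gaussianReal_absolutelyContinuous 1 one_ne_zero)
    (gaussianReal_absolutelyContinuous' 0 one_ne_zero h0)
  simp [measureReal_def, h1]

lemma gaussianRoc_one : gaussianRoc 1 1 = 0 := by
  refine le_antisymm ?_ (roc_nonneg zero_le_one)
  have h : gaussianRoc 1 1 ≤ _ := roc_le (Q := gaussianReal 1 1) MeasurableSet.univ (by simp)
  simpa using h

/-! ### Translates of an even log-concave law -/

/-- The density of `noiseLaw φ` with respect to Lebesgue measure. -/
def noiseDensity {n : ℕ} (φ : Euc n → ℝ) (x : Euc n) : ℝ :=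
  Real.exp (-φ x) / ∫ y, Real.exp (-φ y)

namespace IsPotential

variable {n : ℕ} {φ : Euc n → ℝ}

lemma continuous (hφ : IsPotential φ) : Continuous φ :=
  continuousOn_univ.1 (hφ.convex.continuousOn isOpen_univ)

lemma isProbabilityMeasure (hφ : IsPotential φ) : IsProbabilityMeasure (noiseLaw φ) :=
  isProbabilityMeasure_tilted hφ.integrable_exp

lemma integral_exp_pos (hφ : IsPotential φ) : 0 < ∫ y, Real.exp (-φ y) :=
  MeasureTheory.integral_exp_pos hφ.integrable_exp

lemma continuous_noiseDensity (hφ : IsPotential φ) : Continuous (noiseDensity φ) := by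
  have := hφ.continuous
  unfold noiseDensity
  fun_prop

lemma noiseDensity_pos (hφ : IsPotential φ) (x : Euc n) : 0 < noiseDensity φ x :=
  div_pos (Real.exp_pos _) hφ.integral_exp_pos

lemma integrable_noiseDensity (hφ : IsPotential φ) : Integrable (noiseDensity φ) volume :=
  hφ.integrable_exp.div_const _

lemma measureReal_noiseLaw (hφ : IsPotential φ) (A : Set (Euc n)) :
    (noiseLaw φ).real A = ∫ x in A, noiseDensity φ x := by
  have := hφ.isProbabilityMeasure
  have h := setIntegral_tilted (μ := (volume : Measure (Euc n))) (fun x => -φ x)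
    (fun _ => (1 : ℝ)) A
  simpa [noiseDensity, noiseLaw] using h

lemma measureReal_noiseLaw_map_add (φ : Euc n → ℝ) (w : Euc n) {A : Set (Euc n)}
    (hA : MeasurableSet A) :
    ((noiseLaw φ).map (· + w)).real A = (noiseLaw φ).real {x | x + w ∈ A} :=
  map_measureReal_apply (by fun_prop) hA

lemma measureReal_map_add_eq_integral (hφ : IsPotential φ) (w : Euc n) {A : Set (Euc n)}
    (hA : MeasurableSet A) :
    ((noiseLaw φ).map (· + w)).real A = ∫ x in A, noiseDensity φ (x - w) := by
  rw [measureReal_noiseLaw_map_add φ w hA, hφ.measureReal_noiseLaw]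
  have := (measurePreserving_add_right (volume : Measure (Euc n)) w).setIntegral_preimage_emb
    (measurableEmbedding_addRight w) (fun x => noiseDensity φ (x - w)) A
  simp only [add_sub_cancel_right] at this
  exact this

lemma measureReal_neg (hφ : IsPotential φ) (A : Set (Euc n)) :
    (noiseLaw φ).real {x | -x ∈ A} = (noiseLaw φ).real A := by
  rw [hφ.measureReal_noiseLaw, hφ.measureReal_noiseLaw]
  have := (Measure.measurePreserving_neg (volume : Measure (Euc n))).setIntegral_preimage_emb
    (MeasurableEquiv.neg (Euc n)).measurableEmbedding (noiseDensity φ) A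
  simp only [noiseDensity, hφ.even] at this
  exact this

/-- Under the null hypothesis the log-likelihood ratio of a translation has the law of minus its
law under the alternative, because the law is even. -/
lemma measureReal_le_sub (hφ : IsPotential φ) (v : Euc n) (τ : ℝ) :
    (noiseLaw φ).real {x | τ ≤ φ x - φ (x - v)} =
      (noiseLaw φ).real {x | φ (x + v) - φ x ≤ -τ} := by
  rw [← hφ.measureReal_neg]
  congr 1
  ext x
  have : φ (-x - v) = φ (x + v) := by rw [← hφ.even (x + v)]; congr 1; abel
  simp only [mem_ofPred_eq, this, hφ.even]
  constructor <;> intro h <;> linarith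

lemma mul_noiseDensity_le_iff (hφ : IsPotential φ) (τ : ℝ) (x y : Euc n) :
    Real.exp τ * noiseDensity φ x ≤ noiseDensity φ y ↔ τ ≤ φ x - φ y := by
  rw [noiseDensity, noiseDensity, ← mul_div_assoc,
    div_le_div_iff_of_pos_right hφ.integral_exp_pos, ← Real.exp_add, Real.exp_le_exp]
  constructor <;> intro h <;> linarith

/-- Translating by `s v` with `s ≤ 1` is at least as private as translating by `v`: by convexity,
the likelihood ratio test for the translation by `s v` is an upper set in the direction `v`. -/
lemma map_add_smul_sub_le (hφ : IsPotential φ) (v : Euc n) {s : ℝ} (hs0 : 0 ≤ s) (hs1 : s ≤ 1)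
    (τ : ℝ) {A : Set (Euc n)} (hA : MeasurableSet A) :
    ((noiseLaw φ).map (· + s • v)).real A - Real.exp τ * (noiseLaw φ).real A ≤
      (noiseLaw φ).real {x | τ ≤ φ (x + v) - φ x} -
        Real.exp τ * (noiseLaw φ).real {x | φ (x + v) - φ x ≤ -τ} := by
  have := hφ.isProbabilityMeasure
  have hc := hφ.continuous
  have hNP (w : Euc n) {A : Set (Euc n)} (hA : MeasurableSet A) :
      ((noiseLaw φ).map (· + w)).real A - Real.exp τ * (noiseLaw φ).real A ≤
        ((noiseLaw φ).map (· + w)).real {x | τ ≤ φ x - φ (x - w)} -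
          Real.exp τ * (noiseLaw φ).real {x | τ ≤ φ x - φ (x - w)} := by
    have h := sub_mul_le_of_density (ν := volume) (P := noiseLaw φ)
      (Q := (noiseLaw φ).map (· + w)) (p := noiseDensity φ) (q := fun x => noiseDensity φ (x - w))
      hφ.continuous_noiseDensity.stronglyMeasurable
      (hφ.continuous_noiseDensity.comp (by fun_prop)).stronglyMeasurable
      hφ.integrable_noiseDensity (hφ.integrable_noiseDensity.comp_sub_right w)
      (fun A _ => hφ.measureReal_noiseLaw A)
      (fun A hA => hφ.measureReal_map_add_eq_integral w hA) (Real.exp τ) hA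
    simpa only [hφ.mul_noiseDensity_le_iff] using h
  have hmeas (w : Euc n) : MeasurableSet {x | τ ≤ φ x - φ (x - w)} :=
    measurableSet_le measurable_const (by fun_prop)
  have hup : ((noiseLaw φ).map (· + s • v)).real {x | τ ≤ φ x - φ (x - s • v)} ≤
      ((noiseLaw φ).map (· + v)).real {x | τ ≤ φ x - φ (x - s • v)} := by
    rw [measureReal_noiseLaw_map_add φ _ (hmeas _), measureReal_noiseLaw_map_add φ _ (hmeas _)]
    refine measureReal_mono fun x hx => ?_
    simp only [mem_ofPred_eq, add_sub_cancel_right] at hx ⊢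
    have h1 := hφ.convex.2 (mem_univ x) (mem_univ (x + v)) (sub_nonneg.2 hs1) hs0 (by ring)
    have h2 := hφ.convex.2 (mem_univ x) (mem_univ (x + v)) hs0 (sub_nonneg.2 hs1) (by ring)
    rw [show (1 - s) • x + s • (x + v) = x + s • v by module] at h1
    rw [show s • x + (1 - s) • (x + v) = x + v - s • v by module] at h2
    simp only [smul_eq_mul] at h1 h2
    linarith
  have h1 := hNP (s • v) hA
  have h2 := hNP v (hmeas (s • v))
  rw [measureReal_noiseLaw_map_add φ v (hmeas v)] at h2
  simp only [mem_ofPred_eq, add_sub_cancel_right] at h2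
  rw [hφ.measureReal_le_sub v] at h2
  linarith

/-- Continuity of translations in total variation. -/
lemma exists_le_map_add_add (hφ : IsPotential φ) {η : ℝ} (hη : 0 < η) :
    ∃ r > 0, ∀ w : Euc n, ‖w‖ < r → ∀ A, MeasurableSet A →
      (noiseLaw φ).real A ≤ ((noiseLaw φ).map (· + w)).real A + η := by
  have hc := hφ.continuous_noiseDensity
  have hlim : Tendsto (fun w : Euc n => ∫ x, max (noiseDensity φ x - noiseDensity φ (x - w)) 0)
      (𝓝 0) (𝓝 0) := by
    have h := tendsto_integral_filter_of_dominated_convergence (l := 𝓝 (0 : Euc n))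
      (μ := volume) (F := fun w x => max (noiseDensity φ x - noiseDensity φ (x - w)) 0)
      (f := fun _ => (0 : ℝ)) (noiseDensity φ)
      (.of_forall fun w => by
        have : Continuous fun x => max (noiseDensity φ x - noiseDensity φ (x - w)) 0 := by fun_prop
        exact this.aestronglyMeasurable)
      (.of_forall fun w => .of_forall fun x => by
        rw [Real.norm_of_nonneg (le_max_right _ _)]
        exact max_le (by linarith [hφ.noiseDensity_pos (x - w)]) (hφ.noiseDensity_pos x).le)
      hφ.integrable_noiseDensity
      (.of_forall fun x => by
        have : Continuous fun w => max (noiseDensity φ x - noiseDensity φ (x - w)) 0 := by fun_prop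
        simpa using this.tendsto 0)
    simpa using h
  obtain ⟨r, hr, H⟩ := Metric.eventually_nhds_iff.1 (hlim.eventually_lt_const hη)
  refine ⟨r, hr, fun w hw A hA => ?_⟩
  have hi := hφ.integrable_noiseDensity
  have hiw := hi.comp_sub_right w
  rw [hφ.measureReal_noiseLaw, hφ.measureReal_map_add_eq_integral w hA, ← sub_le_iff_le_add',
    ← integral_sub hi.integrableOn hiw.integrableOn]
  calc ∫ x in A, noiseDensity φ x - noiseDensity φ (x - w)
      ≤ ∫ x in A, max (noiseDensity φ x - noiseDensity φ (x - w)) 0 :=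
        integral_mono (hi.sub hiw).integrableOn (hi.sub hiw).pos_part.integrableOn
          fun x => le_max_left _ _
    _ ≤ ∫ x, max (noiseDensity φ x - noiseDensity φ (x - w)) 0 :=
        setIntegral_le_integral (hi.sub hiw).pos_part (.of_forall fun x => le_max_right _ _)
    _ ≤ η := (H (by simpa using hw)).le

/-! ### Trade-off functions of nearly Gaussian translates -/

/-- The strict inequality in the complementary event is handled by continuity of `Φ`. -/
lemma abs_measureReal_ge_sub_le (hφ : IsPotential φ) {v : Euc n} {δ : ℝ}
    (hKS : ∀ t, |(noiseLaw φ).real {x | φ (x + v) - φ x ≤ t} - normalCDF (t - 1 / 2)| ≤ δ)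
    (τ : ℝ) : |(noiseLaw φ).real {x | τ ≤ φ (x + v) - φ x} - normalCDF (1 / 2 - τ)| ≤ δ := by
  have := hφ.isProbabilityMeasure
  have hc := hφ.continuous
  have hcompl : (noiseLaw φ).real {x | τ ≤ φ (x + v) - φ x} =
      1 - (noiseLaw φ).real {x | φ (x + v) - φ x < τ} := by
    rw [← probReal_compl_eq_one_sub (measurableSet_lt (by fun_prop) measurable_const)]
    congr 1
    ext x
    simp
  have hmono := fun {s : ℝ} (hs : s < τ) =>
    measureReal_mono (μ := noiseLaw φ) (s₁ := {x | φ (x + v) - φ x ≤ s})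
      (s₂ := {x | φ (x + v) - φ x < τ}) (fun x hx => lt_of_le_of_lt hx hs)
  have hle : normalCDF (τ - 1 / 2) - δ ≤ (noiseLaw φ).real {x | φ (x + v) - φ x < τ} := by
    have hcont : Continuous fun s => normalCDF (s - 1 / 2) - δ :=
      (continuous_normalCDF.comp (by fun_prop)).sub continuous_const
    refine le_of_tendsto ((hcont.tendsto τ).mono_left (nhdsWithin_le_nhds (s := Iio τ))) ?_
    filter_upwards [self_mem_nhdsWithin] with s hs
    linarith [(abs_le.1 (hKS s)).1, hmono hs]
  have hge := measureReal_mono (μ := noiseLaw φ) (s₁ := {x | φ (x + v) - φ x < τ})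
    (s₂ := {x | φ (x + v) - φ x ≤ τ}) (fun x (hx : φ (x + v) - φ x < τ) => hx.le)
  have h := abs_le.1 (hKS τ)
  rw [hcompl, show 1 / 2 - τ = -(τ - 1 / 2) by ring, normalCDF_neg, abs_le]
  constructor <;> linarith

variable {v : Euc n} {δ η : ℝ}

/-- Every test at level `α` for a translation by `s v` is dominated by the likelihood ratio test for
the translation by `v` whose Gaussian level is `α + δ`, hence whose actual level is at least `α`. -/
lemma gaussianRoc_sub_le_roc (hφ : IsPotential φ)
    (hKS : ∀ t, |(noiseLaw φ).real {x | φ (x + v) - φ x ≤ t} - normalCDF (t - 1 / 2)| ≤ δ)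
    (hδ : 0 < δ) (hmod : ∀ α β : ℝ, 0 ≤ α → α ≤ β → β ≤ α + δ →
      gaussianRoc 1 α ≤ gaussianRoc 1 β + η)
    {s : ℝ} (hs0 : 0 ≤ s) (hs1 : s ≤ 1) {α : ℝ} (hα : α ∈ Icc (0 : ℝ) 1) :
    gaussianRoc 1 α - (δ + η) ≤ roc (noiseLaw φ) ((noiseLaw φ).map (· + s • v)) α := by
  have := hφ.isProbabilityMeasure
  have : IsProbabilityMeasure ((noiseLaw φ).map (· + s • v)) :=
    Measure.isProbabilityMeasure_map (by fun_prop)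
  rcases lt_or_ge (α + δ) 1 with hlt | hge
  · obtain ⟨b, hb⟩ := exists_normalCDF_eq (add_pos_of_nonneg_of_pos hα.1 hδ) hlt
    have h1 := gaussianRoc_le (α := α + δ) (a := -b) (by rw [neg_neg, hb])
    have h2 := hmod α (α + δ) hα.1 (by linarith) le_rfl
    refine le_roc hα.1 fun A hA hAα => ?_
    -- the Gaussian likelihood ratio `exp (x - 1/2)` at `x = -b` is `exp (-b - 1/2)`
    have h3 := hφ.map_add_smul_sub_le v hs0 hs1 (-b - 1 / 2) hA
    have h4 := (abs_le.1 (hKS (-(-b - 1 / 2)))).1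
    have h5 := (abs_le.1 (hφ.abs_measureReal_ge_sub_le hKS (-b - 1 / 2))).2
    rw [show -(-b - 1 / 2) - 1 / 2 = b by ring, hb] at h4
    rw [show 1 / 2 - (-b - 1 / 2) = 1 - -b by ring] at h5
    have h6 := mul_le_mul_of_nonneg_left
      (show (noiseLaw φ).real A ≤ (noiseLaw φ).real {x | φ (x + v) - φ x ≤ -(-b - 1 / 2)} by
        linarith) (Real.exp_pos (-b - 1 / 2)).le
    linarith
  · have h2 := hmod α 1 hα.1 hα.2 hge
    rw [gaussianRoc_one] at h2
    have := roc_nonneg (P := noiseLaw φ) (Q := (noiseLaw φ).map (· + s • v)) hα.1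
    linarith

/-- The likelihood ratio test of Gaussian level `α - δ` has actual level at most `α`. -/
lemma roc_le_gaussianRoc_add (hφ : IsPotential φ)
    (hKS : ∀ t, |(noiseLaw φ).real {x | φ (x + v) - φ x ≤ t} - normalCDF (t - 1 / 2)| ≤ δ)
    (hδ : 0 < δ) (hmod : ∀ α β : ℝ, 0 ≤ α → α ≤ β → β ≤ α + δ →
      gaussianRoc 1 α ≤ gaussianRoc 1 β + η) {α : ℝ} (hα : α ∈ Icc (0 : ℝ) 1) :
    roc (noiseLaw φ) ((noiseLaw φ).map (· + v)) α ≤ gaussianRoc 1 α + (δ + η) := by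
  have := hφ.isProbabilityMeasure
  have : IsProbabilityMeasure ((noiseLaw φ).map (· + v)) :=
    Measure.isProbabilityMeasure_map (by fun_prop)
  have hc := hφ.continuous
  rcases lt_or_ge δ α with hlt | hge
  · obtain ⟨b, hb⟩ := exists_normalCDF_eq (sub_pos.2 hlt) (by linarith [hα.2])
    have h1 := le_gaussianRoc (α := α - δ) (a := -b) (sub_nonneg.2 hlt.le) (by rw [neg_neg, hb])
    have h2 := hmod (α - δ) α (sub_nonneg.2 hlt.le) (by linarith) (by linarith)
    have h4 := (abs_le.1 (hKS (-(-b - 1 / 2)))).2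
    have h5 := (abs_le.1 (hφ.abs_measureReal_ge_sub_le hKS (-b - 1 / 2))).1
    rw [show -(-b - 1 / 2) - 1 / 2 = b by ring, hb] at h4
    rw [show 1 / 2 - (-b - 1 / 2) = 1 - -b by ring] at h5
    set A : Set (Euc n) := {x | -b - 1 / 2 ≤ φ x - φ (x - v)} with hAdef
    have hA : MeasurableSet A := measurableSet_le measurable_const (by fun_prop)
    have h6 : (noiseLaw φ).real A =
        (noiseLaw φ).real {x | φ (x + v) - φ x ≤ -(-b - 1 / 2)} := hφ.measureReal_le_sub v _
    have h7 := roc_le (P := noiseLaw φ) (Q := (noiseLaw φ).map (· + v)) (α := α) hA (by linarith)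
    rw [measureReal_noiseLaw_map_add φ v hA] at h7
    simp only [hAdef, mem_ofPred_eq, add_sub_cancel_right] at h7
    linarith
  · have h1 := hmod 0 α le_rfl hα.1 (by linarith)
    rw [gaussianRoc_zero] at h1
    have := roc_le_one (P := noiseLaw φ) (Q := (noiseLaw φ).map (· + v)) hα.1
    linarith

lemma exists_roc_smul_le (hφ : IsPotential φ) (hη : 0 < η) :
    ∃ r > 0, ∀ (v : Euc n) (s α : ℝ), ‖v‖ = 1 → 0 ≤ α → |s - 1| < r →
      roc (noiseLaw φ) ((noiseLaw φ).map (· + s • v)) α ≤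
        roc (noiseLaw φ) ((noiseLaw φ).map (· + v)) α + η := by
  obtain ⟨r, hr, H⟩ := hφ.exists_le_map_add_add hη
  refine ⟨r, hr, fun v s α hv hα hs => ?_⟩
  have := hφ.isProbabilityMeasure
  have : IsProbabilityMeasure ((noiseLaw φ).map (· + s • v)) :=
    Measure.isProbabilityMeasure_map (by fun_prop)
  rw [← sub_le_iff_le_add]
  refine le_roc hα fun A hA hAα => ?_
  have hB : MeasurableSet {x : Euc n | x + v ∈ A} := (measurable_add_const v) hA
  have h1 := H ((s - 1) • v) (by rwa [norm_smul, hv, mul_one]) _ hB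
  rw [measureReal_noiseLaw_map_add φ _ hB] at h1
  have h2 : {x : Euc n | x + (s - 1) • v ∈ {x | x + v ∈ A}} = {x | x + s • v ∈ A} := by
    ext x
    simp only [mem_ofPred_eq, show x + (s - 1) • v + v = x + s • v by module]
  have h3 := roc_le (P := noiseLaw φ) (Q := (noiseLaw φ).map (· + s • v)) hA hAα
  rw [measureReal_noiseLaw_map_add φ _ hA] at h3 ⊢
  rw [h2] at h1
  linarith

end IsPotential

/-! ### Convergence in probability on varying spaces -/

/-- The random variables `u n`, each on its own probability space, converge in probability to the
constant `c`. -/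
def TendstoInProb {Ω : ℕ → Type*} [∀ n, MeasurableSpace (Ω n)] (μ : ∀ n, Measure (Ω n))
    (u : ∀ n, Ω n → ℝ) (c : ℝ) : Prop :=
  ∀ ε : ℝ, 0 < ε → Tendsto (fun n => (μ n).real {ω | ε ≤ |u n ω - c|}) atTop (𝓝 0)

namespace TendstoInProb

variable {Ω : ℕ → Type*} [∀ n, MeasurableSpace (Ω n)] {μ : ∀ n, Measure (Ω n)}
  {u v : ∀ n, Ω n → ℝ} {c d : ℝ}

/-- Chebyshev's inequality. -/
lemma of_tendsto_integral_sq (hu : ∀ n, Integrable (fun ω => (u n ω - c) ^ 2) (μ n))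
    (h : Tendsto (fun n => ∫ ω, (u n ω - c) ^ 2 ∂μ n) atTop (𝓝 0)) : TendstoInProb μ u c := by
  intro ε hε
  have h' := h.const_mul (ε ^ 2)⁻¹
  rw [mul_zero] at h'
  refine squeeze_zero (fun _ => measureReal_nonneg) (fun n => ?_) h'
  rw [le_inv_mul_iff₀ (by positivity)]
  have := mul_meas_ge_le_integral_of_nonneg (.of_forall fun ω => sq_nonneg (u n ω - c)) (hu n)
    (ε ^ 2)
  refine le_trans (le_of_eq ?_) this
  congr 2
  ext ω
  simp only [mem_ofPred_eq]
  rw [← sq_abs (u n ω - c), pow_le_pow_iff_left₀ hε.le (abs_nonneg _) two_ne_zero]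

lemma comp_measurePreserving {Ω' : ℕ → Type*} [∀ n, MeasurableSpace (Ω' n)]
    {ν : ∀ n, Measure (Ω' n)} (h : TendstoInProb μ u c) (hu : ∀ n, Measurable (u n))
    {T : ∀ n, Ω' n → Ω n} (hT : ∀ n, MeasurePreserving (T n) (ν n) (μ n)) :
    TendstoInProb ν (fun n ω => u n (T n ω)) c := by
  intro ε hε
  refine (h ε hε).congr fun n => ?_
  have hS : MeasurableSet {ω | ε ≤ |u n ω - c|} :=
    measurableSet_le measurable_const ((hu n).sub_const c).abs
  exact ((hT n).measureReal_preimage hS.nullMeasurableSet).symm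

variable [∀ n, IsProbabilityMeasure (μ n)]

lemma comp (h : TendstoInProb μ u c) {f : ℝ → ℝ} (hf : ContinuousAt f c) :
    TendstoInProb μ (fun n ω => f (u n ω)) (f c) := by
  intro ε hε
  obtain ⟨δ, hδ, H⟩ := Metric.continuousAt_iff.1 hf ε hε
  refine squeeze_zero (fun _ => measureReal_nonneg) (fun n => measureReal_mono fun ω hω => ?_)
    (h δ hδ)
  by_contra hlt
  exact absurd (H (by simpa [Real.dist_eq] using hlt)) (by simpa [Real.dist_eq] using hω)

lemma add (hu : TendstoInProb μ u c) (hv : TendstoInProb μ v d) :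
    TendstoInProb μ (fun n ω => u n ω + v n ω) (c + d) := by
  intro ε hε
  have h := (hu _ (half_pos hε)).add (hv _ (half_pos hε))
  rw [add_zero] at h
  refine squeeze_zero (fun _ => measureReal_nonneg)
    (fun n => (measureReal_mono fun ω hω => ?_).trans (measureReal_union_le _ _)) h
  simp only [mem_ofPred_eq, mem_union] at hω ⊢
  by_contra! hlt
  have : |u n ω + v n ω - (c + d)| ≤ |u n ω - c| + |v n ω - d| := by
    rw [add_sub_add_comm]; exact abs_add_le _ _
  linarith

/-- Convergence in probability implies convergence of expectations of bounded functions. -/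
lemma tendsto_integral {E : Type*} [NormedAddCommGroup E] [NormedSpace ℝ E] [MeasurableSpace E]
    [BorelSpace E] [SecondCountableTopology E] [CompleteSpace E]
    (h : TendstoInProb μ u c) (hu : ∀ n, Measurable (u n)) {f : ℝ → E} (hfm : Measurable f)
    {M : ℝ} (hM : ∀ x, ‖f x‖ ≤ M) (hf : ContinuousAt f c) :
    Tendsto (fun n => ∫ ω, f (u n ω) ∂μ n) atTop (𝓝 (f c)) := by
  rw [Metric.tendsto_atTop]
  intro ε hε
  obtain ⟨δ, hδ, H⟩ := Metric.continuousAt_iff.1 hf (ε / 2) (half_pos hε)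
  have hM0 : 0 ≤ M := (norm_nonneg _).trans (hM 0)
  have h0 := (h δ hδ).const_mul (2 * M)
  rw [mul_zero] at h0
  obtain ⟨N, hN⟩ := eventually_atTop.1 (h0.eventually_lt_const (half_pos hε))
  refine ⟨N, fun n hn => ?_⟩
  have hint : Integrable (fun ω => f (u n ω)) (μ n) :=
    Integrable.of_bound (hfm.comp (hu n)).aestronglyMeasurable M (.of_forall fun ω => hM _)
  have hS : MeasurableSet {ω | δ ≤ |u n ω - c|} :=
    measurableSet_le measurable_const ((hu n).sub_const c).abs
  have hind : Integrable (({ω | δ ≤ |u n ω - c|}).indicator fun _ => 2 * M) (μ n) :=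
    (integrable_const _).indicator hS
  have hsub : ∫ ω, f (u n ω) ∂μ n - f c = ∫ ω, (f (u n ω) - f c) ∂μ n := by
    rw [integral_sub hint (integrable_const _)]
    simp
  rw [dist_eq_norm, hsub]
  calc ‖∫ ω, (f (u n ω) - f c) ∂μ n‖ ≤ ∫ ω, ‖f (u n ω) - f c‖ ∂μ n :=
        norm_integral_le_integral_norm _
    _ ≤ ∫ ω, (ε / 2 + ({ω | δ ≤ |u n ω - c|}).indicator (fun _ => 2 * M) ω) ∂μ n := by
        refine integral_mono (hint.sub (integrable_const _)).norm
          ((integrable_const _).add hind) fun ω => ?_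
        by_cases hω : δ ≤ |u n ω - c|
        · have h1 : ‖f (u n ω) - f c‖ ≤ M + M :=
            (norm_sub_le _ _).trans (add_le_add (hM _) (hM _))
          have : ω ∈ {ω | δ ≤ |u n ω - c|} := hω
          simp only [indicator_of_mem this]
          linarith
        · have : ω ∉ {ω | δ ≤ |u n ω - c|} := hω
          simp only [indicator_of_notMem this, add_zero]
          rw [← dist_eq_norm]
          exact (H (by simpa [Real.dist_eq] using hω)).le
    _ = ε / 2 + 2 * M * (μ n).real {ω | δ ≤ |u n ω - c|} := by
        rw [integral_add (integrable_const _) hind, integral_indicator_const _ hS]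
        simp [mul_comm]
    _ < ε := by linarith [hN n hn]

end TendstoInProb

/-! ### The standard Gaussian vector and the uniform law on the sphere -/

/-- The standard Gaussian law on `ℝⁿ`. -/
def gaussLaw (n : ℕ) : Measure (Euc n) := noiseLaw fun x => ‖x‖ ^ 2 / 2

lemma integrable_exp_neg_sq_norm (n : ℕ) :
    Integrable (fun x : Euc n => Real.exp (-(‖x‖ ^ 2 / 2))) volume := by
  have h := GaussianFourier.integrable_cexp_neg_mul_sq_norm_add (V := Euc n) (b := 1 / 2)
    (by norm_num) 0 0
  refine h.norm.congr (.of_forall fun x => ?_)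
  simp only [Complex.norm_exp]
  congr 1
  simp only [zero_mul, add_zero]
  rw [show (-(1 / 2) * (‖x‖ : ℂ) ^ 2) = ((-(‖x‖ ^ 2 / 2) : ℝ) : ℂ) by push_cast; ring,
    Complex.ofReal_re]

instance (n : ℕ) : IsProbabilityMeasure (gaussLaw n) :=
  isProbabilityMeasure_tilted (integrable_exp_neg_sq_norm n)

/-- The direction of a standard Gaussian vector is uniform on the sphere: in polar coordinates the
Gaussian density depends on the radius only. -/
lemma sphereUniform_eq_gaussLaw {n : ℕ} (hn : 1 ≤ n) {S : Set (UnitSphere n)}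
    (hS : MeasurableSet S) :
    sphereUniform n S = gaussLaw n ((↑) ''
      {x : ({0}ᶜ : Set (Euc n)) | (homeomorphUnitSphereProd (Euc n) x).1 ∈ S}) := by
  have : Nonempty (Fin n) := ⟨⟨0, hn⟩⟩
  set d : ℝ → ENNReal := fun r =>
    ENNReal.ofReal (Real.exp (-(r ^ 2 / 2)) / ∫ x : Euc n, Real.exp (-(‖x‖ ^ 2 / 2))) with hd
  set K : ENNReal := ∫⁻ r, d r ∂(Measure.volumeIoiPow (Module.finrank ℝ (Euc n) - 1))
  have hdm : Measurable d := by fun_prop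
  have key (S : Set (UnitSphere n)) (hS : MeasurableSet S) : gaussLaw n ((↑) ''
      {x : ({0}ᶜ : Set (Euc n)) | (homeomorphUnitSphereProd (Euc n) x).1 ∈ S}) =
      (volume : Measure (Euc n)).toSphere S * K := by
    have hpre : {x : ({0}ᶜ : Set (Euc n)) | (homeomorphUnitSphereProd (Euc n) x).1 ∈ S} =
        homeomorphUnitSphereProd (Euc n) ⁻¹' (S ×ˢ univ) := by
      ext x; simp
    have hmp := (volume : Measure (Euc n)).measurePreserving_homeomorphUnitSphereProd
    rw [gaussLaw, noiseLaw, tilted_apply, hpre,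
      ← setLIntegral_subtype (measurableSet_singleton _).compl _ (fun x : Euc n => d ‖x‖)]
    have h2 := hmp.setLIntegral_comp_preimage (s := S ×ˢ univ) (hS.prod .univ)
      (f := fun p => d p.2) (by fun_prop)
    simp only [homeomorphUnitSphereProd_apply_snd_coe] at h2
    rw [h2, ← Measure.prod_restrict, Measure.restrict_univ]
    have h3 := lintegral_prod_mul (μ := (volume : Measure (Euc n)).toSphere.restrict S)
      (ν := Measure.volumeIoiPow (Module.finrank ℝ (Euc n) - 1)) (f := fun _ => 1)
      (g := fun r => d r) aemeasurable_const (by fun_prop)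
    simp only [one_mul, lintegral_one, Measure.restrict_apply_univ] at h3
    exact h3
  have hK : (volume : Measure (Euc n)).toSphere univ * K = 1 := by
    rw [← key univ .univ]
    have h0 : gaussLaw n {0} = 0 :=
      tilted_absolutelyContinuous _ _ (measure_singleton _)
    have h1 := (prob_compl_eq_one_iff (measurableSet_singleton _)).2 h0
    simp only [mem_univ, ofPred_true, image_univ, Subtype.range_coe]
    exact h1
  rw [key S hS, sphereUniform, Measure.smul_apply, smul_eq_mul, mul_comm,
    ← ENNReal.eq_inv_of_mul_eq_one_left ((mul_comm _ _).trans hK)]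

lemma isProbabilityMeasure_sphereUniform {n : ℕ} (hn : 1 ≤ n) :
    IsProbabilityMeasure (sphereUniform n) := by
  have : Nonempty (Fin n) := ⟨⟨0, hn⟩⟩
  refine ⟨?_⟩
  rw [sphereUniform, Measure.smul_apply, smul_eq_mul]
  exact ENNReal.inv_mul_cancel (Measure.measure_univ_ne_zero.2 (Measure.toSphere_ne_zero _))
    (measure_ne_top _ _)

lemma integral_cexp_inner_gaussLaw (n : ℕ) (w : Euc n) :
    ∫ z, Complex.exp (inner ℝ z w * Complex.I) ∂gaussLaw n =
      Complex.exp (((-(‖w‖ ^ 2 / 2) : ℝ) : ℂ)) := by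
  have h1 := GaussianFourier.integral_cexp_neg_mul_sq_norm_add (V := Euc n) (b := 1 / 2)
    (by norm_num) Complex.I w
  have h2 := GaussianFourier.integral_cexp_neg_mul_sq_norm (V := Euc n) (b := 1 / 2) (by norm_num)
  have hZ : ((∫ x : Euc n, Real.exp (-(‖x‖ ^ 2 / 2)) : ℝ) : ℂ) =
      ∫ v : Euc n, Complex.exp (-(1 / 2) * ‖v‖ ^ 2) := by
    rw [← integral_complex_ofReal]
    congr with x
    push_cast
    congr 1
    ring
  have hZ0 : ((∫ x : Euc n, Real.exp (-(‖x‖ ^ 2 / 2)) : ℝ) : ℂ) ≠ 0 :=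
    Complex.ofReal_ne_zero.2 (integral_exp_pos (integrable_exp_neg_sq_norm n)).ne'
  rw [gaussLaw, noiseLaw, integral_tilted]
  have h3 (z : Euc n) : (Real.exp (-(‖z‖ ^ 2 / 2)) / ∫ x : Euc n, Real.exp (-(‖x‖ ^ 2 / 2))) •
      Complex.exp (inner ℝ z w * Complex.I) =
      Complex.exp (-(1 / 2) * ‖z‖ ^ 2 + Complex.I * inner ℝ w z) *
        ((∫ x : Euc n, Real.exp (-(‖x‖ ^ 2 / 2)) : ℝ) : ℂ)⁻¹ := by
    rw [Complex.real_smul, Complex.exp_add, real_inner_comm]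
    push_cast
    rw [div_eq_mul_inv, show -((‖z‖ : ℂ) ^ 2 / 2) = -(1 / 2) * ‖z‖ ^ 2 by ring,
      mul_comm (inner ℝ w z : ℂ)]
    ring
  simp_rw [h3]
  rw [integral_mul_const, h1, ← h2, ← hZ, mul_comm, ← mul_assoc, inv_mul_cancel₀ hZ0, one_mul,
    Complex.I_sq]
  congr 1
  push_cast
  ring

lemma integral_exp_neg_mul_sq_norm_gaussLaw (n : ℕ) {l : ℝ} (hl : 0 ≤ l) :
    ∫ z, Real.exp (-(l * ‖z‖ ^ 2)) ∂gaussLaw n = (1 + 2 * l) ^ (-((n : ℝ) / 2)) := by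
  have hb : (0 : ℝ) < 1 / 2 + l := by positivity
  have h1 := GaussianFourier.integral_rexp_neg_mul_sq_norm (V := Euc n) hb
  have h2 := GaussianFourier.integral_rexp_neg_mul_sq_norm (V := Euc n) (b := 1 / 2) (by norm_num)
  rw [gaussLaw, noiseLaw, integral_tilted]
  have hZ : ∫ x : Euc n, Real.exp (-(‖x‖ ^ 2 / 2)) = ∫ v : Euc n, Real.exp (-(1 / 2) * ‖v‖ ^ 2) := by
    congr with x
    congr 1
    ring
  have h3 (z : Euc n) : (Real.exp (-(‖z‖ ^ 2 / 2)) / ∫ x : Euc n, Real.exp (-(‖x‖ ^ 2 / 2))) •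
      Real.exp (-(l * ‖z‖ ^ 2)) = Real.exp (-(1 / 2 + l) * ‖z‖ ^ 2) /
        ∫ x : Euc n, Real.exp (-(‖x‖ ^ 2 / 2)) := by
    rw [smul_eq_mul, div_mul_eq_mul_div, ← Real.exp_add]
    congr 2
    ring
  simp_rw [h3]
  rw [integral_div, h1, hZ, h2, ← Real.div_rpow (by positivity) (by positivity),
    Real.rpow_neg (by positivity), ← Real.inv_rpow (by positivity), finrank_euclideanSpace_fin]
  congr 1
  have := Real.pi_ne_zero
  field_simp

/-- The norm of a standard Gaussian vector in `ℝⁿ` concentrates around `√n`. Through its Laplace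
transform, `exp (-‖Z‖² / n)` has expectation tending to `e⁻¹` and variance tending to `0`. -/
lemma tendstoInProb_norm_gaussLaw :
    TendstoInProb gaussLaw (fun n z => ‖z‖ / √(n : ℝ)) 1 := by
  have hlap {a : ℝ} (ha : 0 ≤ a) : Tendsto (fun n : ℕ =>
      ∫ z, Real.exp (-(a / n * ‖z‖ ^ 2)) ∂gaussLaw n) atTop (𝓝 (Real.exp (-a))) := by
    have h := (Real.tendsto_one_add_div_pow_exp (2 * a)).rpow_const (p := -(1 / 2))
      (.inl (Real.exp_pos _).ne')
    rw [← Real.exp_mul, show 2 * a * -(1 / 2) = -a by ring] at h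
    refine h.congr fun n => ?_
    rw [integral_exp_neg_mul_sq_norm_gaussLaw n (by positivity), ← Real.rpow_natCast_mul
      (by positivity)]
    congr 1 <;> ring
  have hint (n : ℕ) (a : ℝ) (ha : 0 ≤ a) :
      Integrable (fun z : Euc n => Real.exp (-(a / n * ‖z‖ ^ 2))) (gaussLaw n) := by
    refine Integrable.of_bound (by fun_prop) 1 (.of_forall fun z => ?_)
    rw [Real.norm_of_nonneg (Real.exp_pos _).le, Real.exp_le_one_iff]
    have : 0 ≤ a / n * ‖z‖ ^ 2 := by positivity
    linarith
  have hexpand (n : ℕ) (z : Euc n) : (Real.exp (-(1 / n * ‖z‖ ^ 2)) - Real.exp (-1)) ^ 2 =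
      Real.exp (-(2 / n * ‖z‖ ^ 2)) - 2 * Real.exp (-1) * Real.exp (-(1 / n * ‖z‖ ^ 2)) +
        Real.exp (-1) ^ 2 := by
    rw [show -(2 / (n : ℝ) * ‖z‖ ^ 2) = -(1 / n * ‖z‖ ^ 2) + -(1 / n * ‖z‖ ^ 2) by ring,
      Real.exp_add]
    ring
  have hi (n : ℕ) : Integrable (fun z : Euc n => Real.exp (-(2 / n * ‖z‖ ^ 2)) -
      2 * Real.exp (-1) * Real.exp (-(1 / n * ‖z‖ ^ 2))) (gaussLaw n) :=
    (hint n 2 (by norm_num)).sub ((hint n 1 (by norm_num)).const_mul (2 * Real.exp (-1)))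
  have hk : TendstoInProb gaussLaw (fun n z => Real.exp (-(1 / n * ‖z‖ ^ 2))) (Real.exp (-1)) := by
    apply TendstoInProb.of_tendsto_integral_sq
    · intro n
      simp_rw [hexpand n]
      exact (hi n).add (integrable_const _)
    · have h := ((hlap (a := 2) (by norm_num)).sub
        ((hlap (a := 1) (by norm_num)).const_mul (2 * Real.exp (-1)))).add_const (Real.exp (-1) ^ 2)
      have h0 : Real.exp (-2) - 2 * Real.exp (-1) * Real.exp (-1) + Real.exp (-1) ^ 2 = 0 := by
        rw [show (-2 : ℝ) = -1 + -1 by norm_num, Real.exp_add]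
        ring
      rw [h0] at h
      refine h.congr fun n => ?_
      simp_rw [hexpand n]
      rw [integral_add (hi n) (integrable_const _),
        integral_sub (hint n 2 (by norm_num)) ((hint n 1 (by norm_num)).const_mul _),
        integral_const_mul]
      simp
  have hc : ContinuousAt (fun y => √(-Real.log y)) (Real.exp (-1)) :=
    (Real.continuousAt_log (Real.exp_pos _).ne').neg.sqrt
  have h := hk.comp hc
  simp only [Real.log_exp, neg_neg, Real.sqrt_one] at h
  convert! h using 3 with n z
  rw [Real.sqrt_mul' _ (sq_nonneg _), Real.sqrt_sq (norm_nonneg _), one_div, Real.sqrt_inv,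
    div_eq_inv_mul]

/-! ### The central limit theorem for random projections -/

/-- The law of two independent `N(m, 1)` variables, on the Euclidean plane. -/
def gaussianPair (m : ℝ) : Measure (Euc 2) :=
  (Measure.pi fun _ : Fin 2 => gaussianReal m 1).map (WithLp.toLp 2)

instance (m : ℝ) : IsProbabilityMeasure (gaussianPair m) :=
  Measure.isProbabilityMeasure_map (by fun_prop)

lemma charFun_gaussianPair (t : ℝ) (ξ : Euc 2) : charFun (gaussianPair (-t)) ξ =
    Complex.exp (((-(t * (ξ 0 + ξ 1)) : ℝ) : ℂ) * Complex.I) *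
      ((Real.exp (-((ξ 0 ^ 2 + ξ 1 ^ 2) / 2)) : ℝ) : ℂ) := by
  rw [gaussianPair, charFun_pi, Fin.prod_univ_two, charFun_gaussianReal, charFun_gaussianReal,
    ← Complex.exp_add, Complex.ofReal_exp, ← Complex.exp_add]
  congr 1
  push_cast
  ring

lemma gaussianPair_eval_eq_zero (m : ℝ) (i : Fin 2) : gaussianPair m {y | y i = 0} = 0 := by
  have : NullSingletonClass (gaussianReal m 1) := nullSingletonClass_gaussianReal one_ne_zero
  rw [gaussianPair, Measure.map_apply (by fun_prop)
    (measurableSet_eq_fun (by fun_prop) measurable_const)]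
  exact Measure.pi_hyperplane _ i 0

lemma measureReal_gaussianPair_Iic (t : ℝ) :
    (gaussianPair (-t)).real {y | y 0 ≤ 0} = normalCDF t := by
  have h := (measurePreserving_eval (fun _ : Fin 2 => gaussianReal (-t) 1) 0).measureReal_preimage
    (measurableSet_Iic (a := (0 : ℝ))).nullMeasurableSet
  rw [measureReal_Iic_gaussianReal, zero_sub, neg_neg] at h
  rw [← h, gaussianPair, map_measureReal_apply (by fun_prop)
    (measurableSet_le (by fun_prop) measurable_const)]
  rfl

lemma measurableSet_quadrant : MeasurableSet {y : Euc 2 | y 0 ≤ 0 ∧ y 1 ≤ 0} := by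
  have h (i : Fin 2) : MeasurableSet {y : Euc 2 | y i ≤ 0} :=
    measurableSet_le (by fun_prop) measurable_const
  exact (h 0).inter (h 1)

lemma measureReal_gaussianPair_Iic_inter_Iic (t : ℝ) :
    (gaussianPair (-t)).real {y | y 0 ≤ 0 ∧ y 1 ≤ 0} = normalCDF t ^ 2 := by
  have h : WithLp.toLp 2 ⁻¹' {y : Euc 2 | y 0 ≤ 0 ∧ y 1 ≤ 0} =
      univ.pi fun _ : Fin 2 => Iic (0 : ℝ) := by
    ext y
    simp only [mem_preimage, mem_ofPred_eq, Set.mem_pi, mem_univ, true_imp_iff, mem_Iic,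
      Fin.forall_fin_two]
  rw [gaussianPair, map_measureReal_apply (by fun_prop) measurableSet_quadrant, h, measureReal_def, Measure.pi_pi,
    Fin.prod_univ_two, ENNReal.toReal_mul, ← measureReal_def, measureReal_Iic_gaussianReal, sq,
    zero_sub, neg_neg]

lemma gaussianPair_frontier_Iic (m : ℝ) : gaussianPair m (frontier {y | y 0 ≤ 0}) = 0 := by
  refine measure_mono_null (fun y hy => ?_) (gaussianPair_eval_eq_zero m 0)
  have hc : Continuous fun y : Euc 2 => y 0 := by fun_prop
  exact frontier_le_subset_eq hc continuous_const hy

lemma gaussianPair_frontier_Iic_inter_Iic (m : ℝ) :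
    gaussianPair m (frontier {y | y 0 ≤ 0 ∧ y 1 ≤ 0}) = 0 := by
  refine measure_mono_null (fun y hy => ?_) (measure_union_null (gaussianPair_eval_eq_zero m 0)
    (gaussianPair_eval_eq_zero m 1))
  have hc (i : Fin 2) : Continuous fun y : Euc 2 => y i := by fun_prop
  rcases frontier_inter_subset {y : Euc 2 | y 0 ≤ 0} {y | y 1 ≤ 0} hy with h | h
  · exact .inl (frontier_le_subset_eq (hc 0) continuous_const h.1)
  · exact .inr (frontier_le_subset_eq (hc 1) continuous_const h.2)

section

variable {Ω : ℕ → Type*} [∀ n, MeasurableSpace (Ω n)]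

/-- The vector `(⟪Z, g x⟫ - t ‖Z‖, ⟪Z, g x'⟫ - t ‖Z‖) / √n`; its coordinates are nonpositive exactly
when the projections of `g x` and of `g x'` on the direction of `Z` are at most `t`. -/
def projPair {Ω : Type*} {n : ℕ} (g : Ω → Euc n) (t : ℝ) (p : Euc n × Ω × Ω) : Euc 2 :=
  WithLp.toLp 2 ![(inner ℝ p.1 (g p.2.1) - t * ‖p.1‖) / √(n : ℝ),
    (inner ℝ p.1 (g p.2.2) - t * ‖p.1‖) / √(n : ℝ)]

lemma measurable_projPair {Ω : Type*} [MeasurableSpace Ω] {n : ℕ} {g : Ω → Euc n}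
    (hg : Measurable g) (t : ℝ) : Measurable (projPair g t) := by
  refine (WithLp.measurable_toLp 2 _).comp (measurable_pi_lambda _ fun i => ?_)
  fin_cases i
  · simp; fun_prop
  · simp; fun_prop

/-- The random projections of two independent copies of `g` on the same Gaussian direction are
asymptotically independent Gaussian variables, as soon as `‖g‖² / n → 1` and independent copies of
`g` are asymptotically orthogonal. -/
lemma tendsto_charFun_projPair {P : ∀ n, Measure (Ω n)} [∀ n, IsProbabilityMeasure (P n)]
    {g : ∀ n, Ω n → Euc n} (hg : ∀ n, Measurable (g n))
    (hnorm : TendstoInProb P (fun n x => ‖g n x‖ ^ 2 / n) 1)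
    (horth : TendstoInProb (fun n => (P n).prod (P n))
      (fun n p => inner ℝ (g n p.1) (g n p.2) / n) 0) (t : ℝ) (ξ : Euc 2) :
    Tendsto (fun n => charFun (((gaussLaw n).prod ((P n).prod (P n))).map (projPair (g n) t)) ξ)
      atTop (𝓝 (charFun (gaussianPair (-t)) ξ)) := by
  set c : ℝ := t * (ξ 0 + ξ 1) with hc
  set w : ∀ n, Ω n × Ω n → Euc n :=
    fun n p => (√(n : ℝ))⁻¹ • (ξ 0 • g n p.1 + ξ 1 • g n p.2) with hw
  have hwm (n) : Measurable (w n) := by fun_prop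
  -- the radial phase factor
  set ψ : ℝ → ℂ := fun r => Complex.exp (((-(c * r) : ℝ) : ℂ) * Complex.I) with hψ
  have hψc : Continuous ψ := by fun_prop
  have hψ1 (r : ℝ) : ‖ψ r‖ = 1 := Complex.norm_exp_ofReal_mul_I _
  have hnormsq : TendstoInProb (fun n => (P n).prod (P n)) (fun n p => ‖w n p‖ ^ 2)
      (ξ 0 ^ 2 + ξ 1 ^ 2) := by
    have hm (n) : Measurable fun x => ‖g n x‖ ^ 2 / (n : ℝ) := by fun_prop
    have h1 := (hnorm.comp_measurePreserving hm (fun n => measurePreserving_fst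
      (μ := P n) (ν := P n))).comp (f := fun a => ξ 0 ^ 2 * a) (by fun_prop)
    have h2 := (hnorm.comp_measurePreserving hm (fun n => measurePreserving_snd
      (μ := P n) (ν := P n))).comp (f := fun a => ξ 1 ^ 2 * a) (by fun_prop)
    have h3 := horth.comp (f := fun a => 2 * ξ 0 * ξ 1 * a) (by fun_prop)
    have h := (h1.add h2).add h3
    simp only [mul_one, mul_zero, add_zero] at h
    convert! h using 3 with n p
    rw [hw]
    simp only [norm_smul, norm_inv, Real.norm_of_nonneg (Real.sqrt_nonneg _), mul_pow, inv_pow,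
      Real.sq_sqrt (Nat.cast_nonneg n), norm_add_sq_real, real_inner_smul_left,
      real_inner_smul_right, Real.norm_eq_abs, sq_abs]
    ring
  have hmain : Tendsto (fun n => ∫ p, Complex.exp (inner ℝ p.1 (w n p.2) * Complex.I)
      ∂((gaussLaw n).prod ((P n).prod (P n)))) atTop
      (𝓝 ((Real.exp (-((ξ 0 ^ 2 + ξ 1 ^ 2) / 2)) : ℝ) : ℂ)) := by
    have h := hnormsq.tendsto_integral (fun n => by fun_prop)
      (f := fun u => ((Real.exp (-(max u 0 / 2)) : ℝ) : ℂ)) (by fun_prop) (M := 1)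
      (fun u => by
        rw [Complex.norm_real, Real.norm_of_nonneg (Real.exp_pos _).le, Real.exp_le_one_iff]
        linarith [le_max_right u 0]) (by fun_prop)
    rw [max_eq_left (by positivity)] at h
    refine h.congr fun n => ?_
    have hI : Integrable (fun p => Complex.exp (inner ℝ p.1 (w n p.2) * Complex.I))
        ((gaussLaw n).prod ((P n).prod (P n))) :=
      Integrable.of_bound (Measurable.aestronglyMeasurable (by fun_prop)) 1
        (.of_forall fun p => (Complex.norm_exp_ofReal_mul_I _).le)
    rw [integral_prod_symm _ hI]
    refine integral_congr_ae (.of_forall fun p => ?_)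
    simp only
    rw [integral_cexp_inner_gaussLaw, max_eq_left (by positivity), Complex.ofReal_exp]
  have hrad : Tendsto (fun n => ∫ z, ‖ψ (‖z‖ / √(n : ℝ)) - ψ 1‖ ∂gaussLaw n) atTop (𝓝 0) := by
    have h := tendstoInProb_norm_gaussLaw.tendsto_integral (fun n => by fun_prop)
      (f := fun r => ‖ψ r - ψ 1‖) (by fun_prop) (M := 2) (fun r => by
        rw [norm_norm]
        calc _ ≤ ‖ψ r‖ + ‖ψ 1‖ := norm_sub_le _ _
          _ = 2 := by rw [hψ1, hψ1]; norm_num) (by fun_prop)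
    simpa using h
  have hsplit (n : ℕ) : charFun (((gaussLaw n).prod ((P n).prod (P n))).map (projPair (g n) t)) ξ =
      ψ 1 * ∫ p, Complex.exp (inner ℝ p.1 (w n p.2) * Complex.I)
          ∂((gaussLaw n).prod ((P n).prod (P n))) +
        ∫ p, Complex.exp (inner ℝ p.1 (w n p.2) * Complex.I) * (ψ (‖p.1‖ / √(n : ℝ)) - ψ 1)
          ∂((gaussLaw n).prod ((P n).prod (P n))) := by
    rw [charFun_apply, integral_map (measurable_projPair (hg n) t).aemeasurable
      (by fun_prop), ← integral_const_mul, ← integral_add]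
    · refine integral_congr_ae (.of_forall fun p => ?_)
      have h1 : (inner ℝ (projPair (g n) t p) ξ : ℝ) =
          inner ℝ p.1 (w n p.2) + -(c * (‖p.1‖ / √(n : ℝ))) := by
        rw [hw, hc]
        simp only [projPair, PiLp.inner_apply, Fin.sum_univ_two, inner_smul_right, inner_add_right]
        simp
        ring
      simp only [h1, hψ]
      rw [Complex.ofReal_add, add_mul, Complex.exp_add]
      ring
    · refine (Integrable.of_bound (Measurable.aestronglyMeasurable (by fun_prop)) 1
        (.of_forall fun p => (Complex.norm_exp_ofReal_mul_I _).le)).const_mul _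
    · refine Integrable.of_bound (Measurable.aestronglyMeasurable (by fun_prop)) 2
        (.of_forall fun p => ?_)
      rw [norm_mul, Complex.norm_exp_ofReal_mul_I, one_mul]
      calc _ ≤ ‖ψ _‖ + ‖ψ 1‖ := norm_sub_le _ _
        _ = 2 := by rw [hψ1, hψ1]; norm_num
  have hzero : Tendsto (fun n => ∫ p, Complex.exp (inner ℝ p.1 (w n p.2) * Complex.I) *
      (ψ (‖p.1‖ / √(n : ℝ)) - ψ 1) ∂((gaussLaw n).prod ((P n).prod (P n)))) atTop (𝓝 0) := by
    refine squeeze_zero_norm (fun n => (norm_integral_le_integral_norm _).trans (le_of_eq ?_)) hrad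
    simp only [norm_mul, Complex.norm_exp_ofReal_mul_I, one_mul]
    rw [integral_fun_fst (fun z : Euc n => ‖ψ (‖z‖ / √(n : ℝ)) - ψ 1‖)]
    simp
  rw [charFun_gaussianPair]
  have h := (hmain.const_mul (ψ 1)).add hzero
  rw [add_zero] at h
  simp only [← hsplit] at h
  simpa only [hψ, mul_one, hc] using h

/-- For a typical direction `z / ‖z‖`, the projection of `g` on this direction is asymptotically
normal: the distribution functions converge in probability over the Gaussian direction. -/
lemma tendstoInProb_measureReal_inner_le {P : ∀ n, Measure (Ω n)}
    [∀ n, IsProbabilityMeasure (P n)] {g : ∀ n, Ω n → Euc n} (hg : ∀ n, Measurable (g n))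
    (hnorm : TendstoInProb P (fun n x => ‖g n x‖ ^ 2 / n) 1)
    (horth : TendstoInProb (fun n => (P n).prod (P n))
      (fun n p => inner ℝ (g n p.1) (g n p.2) / n) 0) (t : ℝ) :
    TendstoInProb gaussLaw (fun n z => (P n).real {x | inner ℝ z (g n x) ≤ t * ‖z‖})
      (normalCDF t) := by
  set Q : ∀ n, Measure (Euc n × Ω n × Ω n) := fun n => (gaussLaw n).prod ((P n).prod (P n))
  have hpm (n) := measurable_projPair (hg n) t
  have hlim := (ProbabilityMeasure.tendsto_iff_tendsto_charFun
    (μ := fun n => ⟨(Q n).map (projPair (g n) t),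
      Measure.isProbabilityMeasure_map (hpm n).aemeasurable⟩)
    (μ₀ := ⟨gaussianPair (-t), inferInstance⟩)).2
    (tendsto_charFun_projPair hg hnorm horth t)
  have hlim1 := ProbabilityMeasure.tendsto_measure_of_null_frontier_of_tendsto' hlim
    (gaussianPair_frontier_Iic (-t))
  have hlim2 := ProbabilityMeasure.tendsto_measure_of_null_frontier_of_tendsto' hlim
    (gaussianPair_frontier_Iic_inter_Iic (-t))
  replace hlim1 := (ENNReal.tendsto_toReal (measure_ne_top (gaussianPair (-t)) _)).comp hlim1
  replace hlim2 := (ENNReal.tendsto_toReal (measure_ne_top (gaussianPair (-t)) _)).comp hlim2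
  have e1 := measureReal_gaussianPair_Iic t
  have e2 := measureReal_gaussianPair_Iic_inter_Iic t
  rw [measureReal_def] at e1 e2
  simp only [ProbabilityMeasure.coe_mk, Function.comp_def, e1, e2] at hlim1 hlim2
  have hAm (n) : MeasurableSet {p : Euc n × Ω n | inner ℝ p.1 (g n p.2) ≤ t * ‖p.1‖} :=
    measurableSet_le (by fun_prop) (by fun_prop)
  have hqm (n) : Measurable fun z => P n {x | inner ℝ z (g n x) ≤ t * ‖z‖} :=
    measurable_measure_prodMk_left (hAm n)
  have hint (n) (k : ℕ) : Integrable
      (fun z => (P n).real {x | inner ℝ z (g n x) ≤ t * ‖z‖} ^ k) (gaussLaw n) := by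
    refine Integrable.of_bound ((hqm n).ennreal_toReal.pow_const k).aestronglyMeasurable 1
      (.of_forall fun z => ?_)
    rw [Real.norm_of_nonneg (by positivity)]
    exact pow_le_one₀ measureReal_nonneg measureReal_le_one
  have hle (n : ℕ) (hn : 1 ≤ n) (a b : ℝ) : (a - b) / √(n : ℝ) ≤ 0 ↔ a ≤ b := by
    rw [div_le_iff₀ (by positivity), zero_mul, sub_nonpos]
  have hE1 : Tendsto (fun n => ∫ z, (P n).real {x | inner ℝ z (g n x) ≤ t * ‖z‖} ∂gaussLaw n)
      atTop (𝓝 (normalCDF t)) := by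
    refine hlim1.congr' ?_
    filter_upwards [eventually_ge_atTop 1] with n hn
    rw [Measure.map_apply (hpm n) (measurableSet_le (by fun_prop) measurable_const)]
    have hset : projPair (g n) t ⁻¹' {y | y 0 ≤ 0} =
        {p | inner ℝ p.1 (g n p.2.1) ≤ t * ‖p.1‖} := by
      ext p
      simp [projPair, hle n hn]
    have hSm : MeasurableSet {p : Euc n × Ω n × Ω n | inner ℝ p.1 (g n p.2.1) ≤ t * ‖p.1‖} :=
      measurableSet_le (by fun_prop) (by fun_prop)
    rw [hset, Measure.prod_apply hSm]
    simp only [measureReal_def]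
    rw [integral_toReal (hqm n).aemeasurable (.of_forall fun z => measure_lt_top _ _)]
    congr 1
    refine lintegral_congr fun z => ?_
    have hz : MeasurableSet {x | inner ℝ z (g n x) ≤ t * ‖z‖} :=
      measurableSet_le (by fun_prop) measurable_const
    exact (measurePreserving_fst (μ := P n) (ν := P n)).measure_preimage hz.nullMeasurableSet
  have hE2 : Tendsto (fun n => ∫ z, (P n).real {x | inner ℝ z (g n x) ≤ t * ‖z‖} ^ 2 ∂gaussLaw n)
      atTop (𝓝 (normalCDF t ^ 2)) := by
    refine hlim2.congr' ?_
    filter_upwards [eventually_ge_atTop 1] with n hn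
    rw [Measure.map_apply (hpm n) measurableSet_quadrant]
    have hset : projPair (g n) t ⁻¹' {y | y 0 ≤ 0 ∧ y 1 ≤ 0} =
        {p | inner ℝ p.1 (g n p.2.1) ≤ t * ‖p.1‖ ∧ inner ℝ p.1 (g n p.2.2) ≤ t * ‖p.1‖} := by
      ext p
      simp [projPair, hle n hn]
    have hSm := hset ▸ hpm n measurableSet_quadrant
    rw [hset, Measure.prod_apply hSm]
    simp only [measureReal_def, ← ENNReal.toReal_pow]
    rw [integral_toReal ((hqm n).pow_const 2).aemeasurable
      (.of_forall fun z => ENNReal.pow_lt_top (measure_lt_top _ _))]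
    congr 1
    refine lintegral_congr fun z => ?_
    rw [sq, ← Measure.prod_prod]
    rfl
  have hexpand (n) (z : Euc n) :
      ((P n).real {x | inner ℝ z (g n x) ≤ t * ‖z‖} - normalCDF t) ^ 2 =
      (P n).real {x | inner ℝ z (g n x) ≤ t * ‖z‖} ^ 2 -
        2 * normalCDF t * (P n).real {x | inner ℝ z (g n x) ≤ t * ‖z‖} ^ 1 +
        normalCDF t ^ 2 := by ring
  have hi (n) : Integrable (fun z => (P n).real {x | inner ℝ z (g n x) ≤ t * ‖z‖} ^ 2 -
      2 * normalCDF t * (P n).real {x | inner ℝ z (g n x) ≤ t * ‖z‖} ^ 1) (gaussLaw n) :=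
    (hint n 2).sub ((hint n 1).const_mul _)
  apply TendstoInProb.of_tendsto_integral_sq
  · intro n
    simp_rw [hexpand n]
    exact (hi n).add (integrable_const _)
  · have h := (hE2.sub (hE1.const_mul (2 * normalCDF t))).add_const (normalCDF t ^ 2)
    rw [show normalCDF t ^ 2 - 2 * normalCDF t * normalCDF t + normalCDF t ^ 2 = 0 by ring] at h
    refine h.congr fun n => ?_
    simp_rw [hexpand n]
    rw [integral_add (hi n) (integrable_const _), integral_sub (hint n 2) ((hint n 1).const_mul _),
      integral_const_mul]
    simp

lemma measurable_measureReal_inner_le {Ω : Type*} [MeasurableSpace Ω] {P : Measure Ω}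
    [IsProbabilityMeasure P] {n : ℕ} {g : Ω → Euc n} (hg : Measurable g) (t : ℝ) :
    Measurable fun v : UnitSphere n => P.real {x | inner ℝ (v : Euc n) (g x) ≤ t} := by
  have : MeasurableSet {p : UnitSphere n × Ω | inner ℝ (p.1 : Euc n) (g p.2) ≤ t} :=
    measurableSet_le (by fun_prop) measurable_const
  exact (measurable_measure_prodMk_left this).ennreal_toReal

/-- The distribution functions of the projections of `g` on a uniform direction converge in
probability. -/
lemma tendsto_sphereUniform_measureReal_inner_le {P : ∀ n, Measure (Ω n)}
    [∀ n, IsProbabilityMeasure (P n)] {g : ∀ n, Ω n → Euc n} (hg : ∀ n, Measurable (g n))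
    (hnorm : TendstoInProb P (fun n x => ‖g n x‖ ^ 2 / n) 1)
    (horth : TendstoInProb (fun n => (P n).prod (P n))
      (fun n p => inner ℝ (g n p.1) (g n p.2) / n) 0) (t : ℝ) :
    TendstoInProb sphereUniform
      (fun n v => (P n).real {x | inner ℝ (v : Euc n) (g n x) ≤ t}) (normalCDF t) := by
  intro ε hε
  refine squeeze_zero' (.of_forall fun _ => measureReal_nonneg) ?_
    (tendstoInProb_measureReal_inner_le hg hnorm horth t ε hε)
  filter_upwards [eventually_ge_atTop 1] with n hn
  have hqm := measurable_measureReal_inner_le (P := P n) (hg n) t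
  have hS : MeasurableSet {v : UnitSphere n |
      ε ≤ |(P n).real {x | inner ℝ (v : Euc n) (g n x) ≤ t} - normalCDF t|} :=
    measurableSet_le measurable_const (hqm.sub_const _).abs
  rw [measureReal_def, sphereUniform_eq_gaussLaw hn hS]
  refine measureReal_mono ?_
  rintro _ ⟨⟨z, hz⟩, hzS, rfl⟩
  have hz0 : 0 < ‖z‖ := norm_pos_iff.2 hz
  simp only [mem_ofPred_eq, homeomorphUnitSphereProd_apply_fst_coe, real_inner_smul_left,
    inv_mul_le_iff₀ hz0] at hzS ⊢
  simpa only [mul_comm t] using hzS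

end

/-! ### Scores of a potential with identity Fisher information -/

lemma measurable_gradient {n : ℕ} (φ : Euc n → ℝ) : Measurable (gradient φ) :=
  (InnerProductSpace.toDual ℝ (Euc n)).symm.continuous.measurable.comp (measurable_fderiv ℝ φ)

namespace IsPotential

variable {n : ℕ} {φ : Euc n → ℝ}

lemma integrable_gradient_mul (hφ : IsPotential φ) (i j : Fin n) :
    Integrable (fun x => gradient φ x i * gradient φ x j) (noiseLaw φ) := by
  have hg := measurable_gradient φ
  refine hφ.fisher_finite.mono' (Measurable.aestronglyMeasurable (by fun_prop))
    (.of_forall fun x => ?_)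
  rw [norm_mul, sq]
  exact mul_le_mul (PiLp.norm_apply_le _ _) (PiLp.norm_apply_le _ _) (norm_nonneg _) (norm_nonneg _)

lemma integral_gradient_mul (hI : fisherInfo φ = 1) (i j : Fin n) :
    ∫ x, gradient φ x i * gradient φ x j ∂noiseLaw φ = if i = j then 1 else 0 := by
  have := congrFun (congrFun hI i) j
  rwa [Matrix.one_apply] at this

lemma integral_inner_gradient_sq (hφ : IsPotential φ) (hI : fisherInfo φ = 1) (y : Euc n) :
    ∫ x, inner ℝ y (gradient φ x) ^ 2 ∂noiseLaw φ = ‖y‖ ^ 2 := by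
  have h (x : Euc n) : inner ℝ y (gradient φ x) ^ 2 =
      ∑ i, ∑ j, y i * y j * (gradient φ x i * gradient φ x j) := by
    rw [sq, PiLp.inner_apply, Finset.sum_mul_sum]
    refine Finset.sum_congr rfl fun i _ => Finset.sum_congr rfl fun j _ => ?_
    simp only [RCLike.inner_apply, conj_trivial]
    ring
  simp_rw [h]
  rw [integral_finsetSum _ fun i _ => integrable_finsetSum _ fun j _ =>
    (hφ.integrable_gradient_mul i j).const_mul _]
  simp_rw [integral_finsetSum _ fun j _ => (hφ.integrable_gradient_mul _ j).const_mul _,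
    integral_const_mul, integral_gradient_mul hI]
  rw [EuclideanSpace.real_norm_sq_eq]
  simp [sq]

lemma integral_norm_gradient_sq (hφ : IsPotential φ) (hI : fisherInfo φ = 1) :
    ∫ x, ‖gradient φ x‖ ^ 2 ∂noiseLaw φ = n := by
  simp_rw [EuclideanSpace.real_norm_sq_eq, sq]
  rw [integral_finsetSum _ fun i _ => hφ.integrable_gradient_mul i i]
  simp [integral_gradient_mul hI]

lemma integrable_inner_gradient_sq (hφ : IsPotential φ) :
    Integrable (fun p : Euc n × Euc n => inner ℝ (gradient φ p.1) (gradient φ p.2) ^ 2)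
      ((noiseLaw φ).prod (noiseLaw φ)) := by
  have := hφ.isProbabilityMeasure
  have hg := measurable_gradient φ
  refine (hφ.fisher_finite.mul_prod hφ.fisher_finite).mono'
    (Measurable.aestronglyMeasurable (by fun_prop)) (.of_forall fun p => ?_)
  rw [Real.norm_of_nonneg (sq_nonneg _), ← mul_pow, ← sq_abs]
  exact pow_le_pow_left₀ (abs_nonneg _) (abs_real_inner_le_norm _ _) 2

lemma integral_prod_inner_gradient_sq (hφ : IsPotential φ) (hI : fisherInfo φ = 1) :
    ∫ p, inner ℝ (gradient φ p.1) (gradient φ p.2) ^ 2 ∂((noiseLaw φ).prod (noiseLaw φ)) = n := by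
  have := hφ.isProbabilityMeasure
  rw [integral_prod _ hφ.integrable_inner_gradient_sq]
  simp_rw [hφ.integral_inner_gradient_sq hI]
  exact hφ.integral_norm_gradient_sq hI

end IsPotential

section

variable {φ : ∀ n : ℕ, Euc n → ℝ}

/-- In dimension `0`, where nothing is assumed on `φ`, the law is the point mass. -/
lemma isProbabilityMeasure_noiseLaw (hφ : ∀ n : ℕ, 1 ≤ n → IsPotential (φ n)) (n : ℕ) :
    IsProbabilityMeasure (noiseLaw (φ n)) := by
  rcases Nat.eq_zero_or_pos n with rfl | hn
  · have : IsFiniteMeasure (volume : Measure (Euc 0)) := inferInstance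
    exact isProbabilityMeasure_tilted .of_finite
  · exact (hφ n hn).isProbabilityMeasure

/-- The scores of two independent noise vectors are asymptotically orthogonal: their inner product
has second moment `tr I² = n`. -/
lemma tendstoInProb_inner_gradient (hφ : ∀ n : ℕ, 1 ≤ n → IsPotential (φ n))
    (hI : ∀ n : ℕ, 1 ≤ n → fisherInfo (φ n) = 1) :
    TendstoInProb (fun n => (noiseLaw (φ n)).prod (noiseLaw (φ n)))
      (fun n p => inner ℝ (gradient (φ n) p.1) (gradient (φ n) p.2) / n) 0 := by
  apply TendstoInProb.of_tendsto_integral_sq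
  · intro n
    rcases Nat.eq_zero_or_pos n with rfl | hn
    · simp
    · simp_rw [sub_zero, div_pow]
      exact (hφ n hn).integrable_inner_gradient_sq.div_const _
  · refine tendsto_one_div_atTop_nhds_zero_nat.congr' ?_
    filter_upwards [eventually_ge_atTop 1] with n hn
    simp_rw [sub_zero, div_pow]
    rw [integral_div, (hφ n hn).integral_prod_inner_gradient_sq (hI n hn)]
    field_simp

/-- The projections of the score on most directions are asymptotically standard normal. -/
lemma tendstoInProb_measureReal_inner_gradient_le (hφ : ∀ n : ℕ, 1 ≤ n → IsPotential (φ n))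
    (hI : ∀ n : ℕ, 1 ≤ n → fisherInfo (φ n) = 1) (hD2 : CondD2 φ) (t : ℝ) :
    TendstoInProb sphereUniform (fun n v => (noiseLaw (φ n)).real
      {x | inner ℝ (v : Euc n) (gradient (φ n) x) ≤ t}) (normalCDF t) := by
  have hprob := isProbabilityMeasure_noiseLaw hφ
  have hnorm : TendstoInProb (fun n => noiseLaw (φ n)) (fun n x => ‖gradient (φ n) x‖ ^ 2 / n) 1 := by
    have h : TendstoInProb (fun n => noiseLaw (φ n)) (fun n x => ‖gradient (φ n) x‖ / √(n : ℝ)) 1 :=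
      hD2
    have h' := h.comp (f := fun r => r ^ 2) (by fun_prop)
    simpa only [div_pow, Real.sq_sqrt (Nat.cast_nonneg _), one_pow] using h'
  exact tendsto_sphereUniform_measureReal_inner_le (fun n => measurable_gradient (φ n)) hnorm
    (tendstoInProb_inner_gradient hφ hI) t

end

/-! ### Kolmogorov-Smirnov distances -/

lemma abs_cdf_sub_le_ksDist (μ ν : Measure ℝ) (t : ℝ) : |cdf μ t - cdf ν t| ≤ ksDist μ ν := by
  refine le_ciSup (f := fun t => |cdf μ t - cdf ν t|) ⟨1, ?_⟩ t
  rintro _ ⟨s, rfl⟩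
  rw [abs_le]
  constructor <;>
    linarith [cdf_nonneg μ s, cdf_nonneg ν s, cdf_le_one μ s, cdf_le_one ν s]

/-- Closeness to the normal distribution function on a suitable finite set of quantiles implies
uniform closeness. -/
lemma exists_finset_abs_sub_normalCDF_le {ε : ℝ} (hε : 0 < ε) :
    ∃ T : Finset ℝ, ∀ F : ℝ → ℝ, Monotone F → (∀ t, 0 ≤ F t) → (∀ t, F t ≤ 1) →
      (∀ t ∈ T, |F t - normalCDF t| < ε) → ∀ t, |F t - normalCDF t| ≤ 2 * ε := by
  obtain ⟨k, hk⟩ := exists_nat_one_div_lt hε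
  set m : ℕ := k + 1
  have hm : (0 : ℝ) < m := by positivity
  have hmε : 1 / (m : ℝ) < ε := by simpa [m] using hk
  have hex : ∀ j : ℕ, ∃ a, 0 < j → j < m → normalCDF a = j / m := fun j => by
    by_cases h : 0 < j ∧ j < m
    · obtain ⟨a, ha⟩ := exists_normalCDF_eq (p := j / m) (div_pos (Nat.cast_pos.2 h.1) hm)
        ((div_lt_one hm).2 (Nat.cast_lt.2 h.2))
      exact ⟨a, fun _ _ => ha⟩
    · exact ⟨0, fun h1 h2 => absurd ⟨h1, h2⟩ h⟩
  choose a ha using hex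
  refine ⟨(Finset.range m).image a, fun F hF h0 h1 hT t => ?_⟩
  have hclose (j : ℕ) (hj : 0 < j) (hjm : j < m) : |F (a j) - j / m| < ε := by
    rw [← ha j hj hjm]
    exact hT _ (Finset.mem_image_of_mem _ (Finset.mem_range.2 hjm))
  have hΦ0 := normalCDF_nonneg t
  have hΦ1 := normalCDF_le_one t
  have hmm : (m : ℝ) * (1 / m) = 1 := mul_one_div_cancel hm.ne'
  rw [abs_le]
  constructor
  · -- the largest quantile level below `Φ t`
    rcases le_or_gt (normalCDF t) (1 / m) with hle | hgt
    · linarith [h0 t]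
    have h1m : 1 < m * normalCDF t := by rw [← hmm]; exact mul_lt_mul_of_pos_left hgt hm
    obtain ⟨j, hj⟩ : ∃ j, ⌈m * normalCDF t⌉₊ = j + 1 :=
      Nat.exists_eq_succ_of_ne_zero (Nat.ceil_pos.2 (by linarith)).ne'
    have hjle : (m : ℝ) * normalCDF t ≤ j + 1 := by
      have := Nat.le_ceil (m * normalCDF t)
      rw [hj] at this; exact_mod_cast this
    have hjlt : (j : ℝ) < m * normalCDF t := by
      have := Nat.ceil_lt_add_one (a := m * normalCDF t) (by linarith)
      rw [hj] at this; push_cast at this; linarith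
    have hj0 : 0 < j := by
      have : (0 : ℝ) < j := by linarith
      exact_mod_cast this
    have hjm : j < m := by
      have : (j : ℝ) < m := by nlinarith
      exact_mod_cast this
    have hjd : (j : ℝ) / m < normalCDF t := by rwa [div_lt_iff₀ hm, mul_comm]
    have hat : a j ≤ t := by
      by_contra! hlt
      have := normalCDF_mono hlt.le
      rw [ha j hj0 hjm] at this
      linarith
    have h2 : normalCDF t ≤ j / m + 1 / m := by
      rw [← add_div, le_div_iff₀ hm, mul_comm]; exact hjle
    linarith [(abs_lt.1 (hclose j hj0 hjm)).1, hF hat]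
  · -- the smallest quantile level above `Φ t`
    rcases le_or_gt 1 (normalCDF t + 1 / m) with hle | hgt
    · linarith [h1 t]
    set j := ⌊m * normalCDF t⌋₊ + 1
    have hjlt : (m : ℝ) * normalCDF t < j := by
      have := Nat.lt_floor_add_one (m * normalCDF t)
      simpa [j] using this
    have hjle : (j : ℝ) ≤ m * normalCDF t + 1 := by
      have := Nat.floor_le (a := m * normalCDF t) (by positivity)
      simpa [j] using this
    have hjd : (j : ℝ) / m ≤ normalCDF t + 1 / m := by
      rw [div_le_iff₀ hm, add_mul, mul_comm, mul_comm (1 / (m : ℝ)), hmm]; exact hjle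
    have hjm : j < m := by
      have : (j : ℝ) / m < 1 := hjd.trans_lt hgt
      rw [div_lt_one hm] at this
      exact_mod_cast this
    have hdj : normalCDF t < j / m := by rwa [lt_div_iff₀ hm, mul_comm]
    have hat : t ≤ a j := by
      by_contra! hlt
      have := normalCDF_mono hlt.le
      rw [ha j (Nat.succ_pos _) hjm] at this
      linarith
    linarith [(abs_lt.1 (hclose j (Nat.succ_pos _) hjm)).2, hF hat]

section

variable {φ : ∀ n : ℕ, Euc n → ℝ}

lemma likelihoodProj_of_fisherInfo_eq_one {n : ℕ} {φ : Euc n → ℝ} (hI : fisherInfo φ = 1)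
    (v : UnitSphere n) (x : Euc n) :
    likelihoodProj φ (v : Euc n) x = φ (x + v) - φ x - 1 / 2 := by
  have hv : ‖(v : Euc n)‖ = 1 := by simp
  have h : dotProduct (v : Euc n).ofLp (v : Euc n).ofLp = 1 := by
    have := EuclideanSpace.real_norm_sq_eq (v : Euc n)
    rw [hv] at this
    simp only [dotProduct, ← sq]
    linarith
  rw [likelihoodProj, hI, Matrix.one_mulVec, h, mul_one]

/-- For most directions `v`, the log-likelihood ratio `φ (x + v) - φ x` is nearly `N(1/2, 1)`. -/
lemma eventually_exists_abs_sub_normalCDF_le (hφ : ∀ n : ℕ, 1 ≤ n → IsPotential (φ n))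
    (hI : ∀ n : ℕ, 1 ≤ n → fisherInfo (φ n) = 1) (hD1 : CondD1 φ) (hD2 : CondD2 φ)
    {ε : ℝ} (hε : 0 < ε) : ∀ᶠ n in atTop, ∃ E : Set (UnitSphere n), MeasurableSet E ∧
      1 - ε < (sphereUniform n).real E ∧ ∀ v ∈ E, ∀ t,
        |(noiseLaw (φ n)).real {x | φ n (x + (v : Euc n)) - φ n x ≤ t} - normalCDF (t - 1 / 2)|
          ≤ ε := by
  obtain ⟨b, Ω, hb, hΩ⟩ := hD1
  obtain ⟨T, hT⟩ := exists_finset_abs_sub_normalCDF_le (ε := ε / 4) (by positivity)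
  set bad : ∀ n, ℝ → Set (UnitSphere n) := fun n t => {v | ε / 4 ≤ |(noiseLaw (φ n)).real
    {x | inner ℝ (v : Euc n) (gradient (φ n) x) ≤ t} - normalCDF t|} with hbad
  have hsum : Tendsto (fun n => b n + ∑ t ∈ T, (sphereUniform n).real (bad n t)) atTop (𝓝 0) := by
    have h := tendsto_finsetSum T fun t _ =>
      tendstoInProb_measureReal_inner_gradient_le hφ hI hD2 t (ε / 4) (by positivity)
    rw [Finset.sum_const_zero] at h
    simpa only [add_zero] using hb.add h
  filter_upwards [hsum.eventually_lt_const hε, hb.eventually_lt_const (half_pos hε),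
    eventually_ge_atTop 1] with n hn1 hn2 hn
  obtain ⟨hΩm, hΩσ, hΩks⟩ := hΩ n hn
  have hpot := hφ n hn
  have := hpot.isProbabilityMeasure
  have := isProbabilityMeasure_sphereUniform hn
  have hg := measurable_gradient (φ n)
  have hc := hpot.continuous
  have hbm (t : ℝ) : MeasurableSet (bad n t) :=
    measurableSet_le measurable_const ((measurable_measureReal_inner_le hg t).sub_const _).abs
  refine ⟨Ω n \ ⋃ t ∈ T, bad n t, hΩm.diff (T.measurableSet_biUnion fun t _ => hbm t), ?_, ?_⟩
  · have h1 := measureReal_biUnion_finset_le (μ := sphereUniform n) T (bad n)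
    have h2 : (sphereUniform n).real (Ω n) ≤ (sphereUniform n).real (Ω n \ ⋃ t ∈ T, bad n t) +
        (sphereUniform n).real (⋃ t ∈ T, bad n t) := by
      refine le_trans (measureReal_mono ?_) (measureReal_union_le _ _)
      rw [sdiff_union_self]
      exact subset_union_left
    linarith
  · rintro v ⟨hvΩ, hvbad⟩ t
    have hvT : ∀ t ∈ T, |(noiseLaw (φ n)).real
        {x | inner ℝ (v : Euc n) (gradient (φ n) x) ≤ t} - normalCDF t| < ε / 4 := by
      intro t ht
      by_contra! hle
      exact hvbad (mem_biUnion ht hle)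
    have hF := hT (fun t => (noiseLaw (φ n)).real
        {x | inner ℝ (v : Euc n) (gradient (φ n) x) ≤ t})
      (fun s t hst => measureReal_mono fun x hx => le_trans hx hst)
      (fun t => measureReal_nonneg) (fun t => measureReal_le_one) hvT (t - 1 / 2)
    have hm1 : Measurable (likelihoodProj (φ n) (v : Euc n)) := by
      have : likelihoodProj (φ n) (v : Euc n) = fun x => φ n (x + v) - φ n x - 1 / 2 :=
        funext (likelihoodProj_of_fisherInfo_eq_one (hI n hn) v)
      rw [this]
      fun_prop
    have hm2 : Measurable fun x => (inner ℝ (v : Euc n) (gradient (φ n) x) : ℝ) := by fun_prop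
    have := Measure.isProbabilityMeasure_map (μ := noiseLaw (φ n)) hm1.aemeasurable
    have := Measure.isProbabilityMeasure_map (μ := noiseLaw (φ n)) hm2.aemeasurable
    have hks := (abs_cdf_sub_le_ksDist _ _ (t - 1 / 2)).trans (hΩks v hvΩ)
    rw [cdf_eq_real, cdf_eq_real, map_measureReal_apply hm1 measurableSet_Iic,
      map_measureReal_apply hm2 measurableSet_Iic] at hks
    have hset : likelihoodProj (φ n) (v : Euc n) ⁻¹' Iic (t - 1 / 2) =
        {x | φ n (x + (v : Euc n)) - φ n x ≤ t} := by
      ext x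
      simp [likelihoodProj_of_fisherInfo_eq_one (hI n hn)]
    rw [hset] at hks
    have h3 := (abs_sub_le _ _ _).trans (add_le_add hks hF)
    linarith

end

/-! ### Trade-off functions of the mechanism -/

lemma roc_map_measurableEquiv {Ω Ω' : Type*} [MeasurableSpace Ω] [MeasurableSpace Ω']
    (P Q : Measure Ω) (e : Ω ≃ᵐ Ω') (α : ℝ) : roc (P.map e) (Q.map e) α = roc P Q α := by
  have hmap (μ : Measure Ω) (A : Set Ω') : (μ.map e).real A = μ.real (e ⁻¹' A) := by
    rw [measureReal_def, e.map_apply, measureReal_def]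
  unfold roc
  congr 1
  ext β
  simp only [hmap]
  constructor
  · rintro ⟨A, hA, hα, rfl⟩
    exact ⟨e ⁻¹' A, e.measurable hA, hα, rfl⟩
  · rintro ⟨A, hA, hα, rfl⟩
    have : e ⁻¹' (e.symm ⁻¹' A) = A := by ext x; simp
    exact ⟨e.symm ⁻¹' A, e.symm.measurable hA, by rwa [this], by rw [this]⟩

lemma roc_mechanism {𝒳 : Type*} {k n : ℕ} (φ : Euc n → ℝ) (f : (Fin k → 𝒳) → Euc n)
    (D D' : Fin k → 𝒳) (α : ℝ) : roc (mechanism φ f D) (mechanism φ f D') α =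
      roc (noiseLaw φ) ((noiseLaw φ).map (· + (f D' - f D))) α := by
  have h : mechanism φ f D' =
      ((noiseLaw φ).map (· + (f D' - f D))).map (MeasurableEquiv.addLeft (f D)) := by
    rw [MeasurableEquiv.coe_addLeft, Measure.map_map (by fun_prop) (by fun_prop), mechanism]
    congr 1
    ext1 x
    simp only [Function.comp_apply]
    abel
  rw [h]
  exact roc_map_measurableEquiv _ _ (MeasurableEquiv.addLeft (f D)) α

lemma NeighboringAlong.exists_sub_eq_smul {𝒳 : Type*} {k n : ℕ} {f : (Fin k → 𝒳) → Euc n}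
    {E : Set (UnitSphere n)} {D D' : Fin k → 𝒳} (h : NeighboringAlong f E D D') :
    ∃ v ∈ E, f D' - f D = ‖f D' - f D‖ • (v : Euc n) := by
  obtain ⟨-, v, hvE, hv⟩ := h
  refine ⟨v, hvE, ?_⟩
  have h1 : ‖(v : Euc n)‖ = 1 := by simp
  have h0 : ‖f D' - f D‖ ≠ 0 := by
    intro h0
    rw [hv, h0] at h1
    simp at h1
  rw [hv, smul_inv_smul₀ h0]

/-- A property that holds eventually at every scale `ε` holds along some scale tending to `0`. -/
lemma exists_tendsto_zero_of_eventually {p : ℕ → ℝ → Prop}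
    (hmono : ∀ n c c', p n c → c ≤ c' → p n c') (h0 : ∀ n, ∃ c > 0, p n c)
    (h : ∀ ε > 0, ∀ᶠ n in atTop, p n ε) :
    ∃ c : ℕ → ℝ, (∀ n, 0 < c n) ∧ Tendsto c atTop (𝓝 0) ∧ ∀ n, p n (c n) := by
  have hpos (n : ℕ) : (0 : ℝ) < 1 / (n + 1) := by positivity
  have hnn (n : ℕ) : 0 ≤ sInf {c | 0 < c ∧ p n c} := Real.sInf_nonneg fun c hc => hc.1.le
  refine ⟨fun n => sInf {c | 0 < c ∧ p n c} + 1 / (n + 1), fun n => by linarith [hpos n, hnn n],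
    ?_, fun n => ?_⟩
  · have hlim : Tendsto (fun n => sInf {c | 0 < c ∧ p n c}) atTop (𝓝 0) := by
      refine tendsto_order.2 ⟨fun a ha => .of_forall fun n => ha.trans_le (hnn n), fun a ha => ?_⟩
      filter_upwards [h (a / 2) (half_pos ha)] with n hn
      have := csInf_le (s := {c | 0 < c ∧ p n c}) ⟨0, fun c hc => hc.1.le⟩ ⟨half_pos ha, hn⟩
      linarith
    simpa using hlim.add tendsto_one_div_add_atTop_nhds_zero_nat
  · obtain ⟨c, hc, hlt⟩ := exists_lt_of_csInf_lt (s := {c | 0 < c ∧ p n c})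
      (let ⟨c, hc⟩ := h0 n; ⟨c, hc⟩) (lt_add_of_pos_right _ (hpos n))
    exact hmono n c _ hc.2 hlt.le

/-- On a set `E` of directions of measure more than `1 - c`, the trade-off functions of the
translates of the law in the directions of `E` are those of `N(0,1)` and `N(1,1)` up to `c`: from
above for translations of length `1`, from below for those of length at most `1`. -/
def NearlyGaussianTradeoff {n : ℕ} (φ : Euc n → ℝ) (c : ℝ) (E : Set (UnitSphere n)) : Prop :=
  MeasurableSet E ∧ 1 - c < (sphereUniform n).real E ∧
    (∀ v ∈ E, ∀ s ∈ Icc (0 : ℝ) 1, ∀ α ∈ Icc (0 : ℝ) 1,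
      gaussianRoc 1 α - c ≤ roc (noiseLaw φ) ((noiseLaw φ).map (· + s • (v : Euc n))) α) ∧
    ∀ v ∈ E, ∀ α ∈ Icc (0 : ℝ) 1,
      roc (noiseLaw φ) ((noiseLaw φ).map (· + (v : Euc n))) α ≤ gaussianRoc 1 α + c

lemma NearlyGaussianTradeoff.mono {n : ℕ} {φ : Euc n → ℝ} {c c' : ℝ} {E : Set (UnitSphere n)}
    (h : NearlyGaussianTradeoff φ c E) (hc : c ≤ c') : NearlyGaussianTradeoff φ c' E :=
  ⟨h.1, by linarith [h.2.1], fun v hv s hs α hα => by linarith [h.2.2.1 v hv s hs α hα],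
    fun v hv α hα => by linarith [h.2.2.2 v hv α hα]⟩

lemma exists_nearlyGaussianTradeoff {φ : ∀ n : ℕ, Euc n → ℝ}
    (hφ : ∀ n : ℕ, 1 ≤ n → IsPotential (φ n)) (hI : ∀ n : ℕ, 1 ≤ n → fisherInfo (φ n) = 1)
    (hD1 : CondD1 φ) (hD2 : CondD2 φ) :
    ∃ c : ℕ → ℝ, (∀ n, 0 < c n) ∧ Tendsto c atTop (𝓝 0) ∧
      ∀ n, 1 ≤ n → ∃ E, NearlyGaussianTradeoff (φ n) (c n) E := by
  refine exists_tendsto_zero_of_eventually (p := fun n c => 1 ≤ n →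
      ∃ E, NearlyGaussianTradeoff (φ n) c E)
    (fun n c c' h hc hn => (h hn).imp fun E hE => hE.mono hc)
    (fun n => ⟨1, one_pos, fun hn => ?_⟩) fun ε hε => ?_
  · have := (hφ n hn).isProbabilityMeasure
    have := isProbabilityMeasure_sphereUniform hn
    have hQ (w : Euc n) : IsProbabilityMeasure ((noiseLaw (φ n)).map (· + w)) :=
      Measure.isProbabilityMeasure_map (by fun_prop)
    refine ⟨univ, .univ, by simp, fun v _ s _ α hα => ?_, fun v _ α hα => ?_⟩
    · have h1 : gaussianRoc 1 α ≤ 1 := roc_le_one hα.1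
      have h2 := roc_nonneg (P := noiseLaw (φ n))
        (Q := (noiseLaw (φ n)).map (· + s • (v : Euc n))) hα.1
      linarith
    · have h1 : 0 ≤ gaussianRoc 1 α := roc_nonneg hα.1
      have h2 := roc_le_one (P := noiseLaw (φ n))
        (Q := (noiseLaw (φ n)).map (· + (v : Euc n))) hα.1
      linarith
  · obtain ⟨δ₀, hδ₀, hmod⟩ := gaussianRoc_modulus (half_pos hε)
    have hδ : 0 < min δ₀ (ε / 2) := lt_min hδ₀ (half_pos hε)
    have hδε := min_le_right δ₀ (ε / 2)
    have hmod' : ∀ α β : ℝ, 0 ≤ α → α ≤ β → β ≤ α + min δ₀ (ε / 2) →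
        gaussianRoc 1 α ≤ gaussianRoc 1 β + ε / 2 := fun α β h1 h2 h3 =>
      hmod α β h1 h2 (h3.trans (by gcongr; exact min_le_left _ _))
    filter_upwards [eventually_exists_abs_sub_normalCDF_le hφ hI hD1 hD2 hδ] with n hE hn
    obtain ⟨E, hEm, hEσ, hE⟩ := hE
    refine ⟨E, hEm, by linarith, fun v hv s hs α hα => ?_, fun v hv α hα => ?_⟩
    · linarith [(hφ n hn).gaussianRoc_sub_le_roc (hE v hv) hδ hmod' hs.1 hs.2 hα]
    · linarith [(hφ n hn).roc_le_gaussianRoc_add (hE v hv) hδ hmod' hα]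

end PrivacyCLT

end

theorem theorem3p1
    (φ : ∀ n : ℕ, PrivacyCLT.Euc n → ℝ)
    (hφ : ∀ n : ℕ, 1 ≤ n → PrivacyCLT.IsPotential (φ n))
    (hI : ∀ n : ℕ, 1 ≤ n → PrivacyCLT.fisherInfo (φ n) = 1)
    (hD1 : PrivacyCLT.CondD1 φ)
    (hD2 : PrivacyCLT.CondD2 φ) :
    ∃ (c : ℕ → ℝ) (E : ∀ n : ℕ, Set (PrivacyCLT.UnitSphere n)),
      (∀ n, 0 < c n) ∧ Tendsto c atTop (𝓝 0) ∧
      ∀ n : ℕ, 1 ≤ n →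
        MeasurableSet (E n) ∧
        1 - c n < (PrivacyCLT.sphereUniform n).real (E n) ∧
        ∀ (𝒳 : Type*) (k : ℕ) (f : (Fin k → 𝒳) → PrivacyCLT.Euc n),
          PrivacyCLT.HasSensitivity f 1 →
          -- privacy lower bound, for every query of sensitivity 1
          (∀ D D' : Fin k → 𝒳, PrivacyCLT.NeighboringAlong f (E n) D D' →
            ∀ α ∈ Icc (0 : ℝ) 1,
              PrivacyCLT.gaussianRoc 1 α - c n ≤
                PrivacyCLT.roc (PrivacyCLT.mechanism (φ n) f D)
                  (PrivacyCLT.mechanism (φ n) f D') α) ∧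
          -- two-sided bound, when the sensitivity is still 1 along the directions in `E n`
          (PrivacyCLT.HasSensitivityAlong f (E n) 1 →
            ∀ α ∈ Icc (0 : ℝ) 1,
              |PrivacyCLT.infRoc (φ n) f (E n) α - PrivacyCLT.gaussianRoc 1 α| ≤ c n) := by
  obtain ⟨c, hc0, hc, hE⟩ := PrivacyCLT.exists_nearlyGaussianTradeoff hφ hI hD1 hD2
  choose E hE using hE
  refine ⟨c, fun n => if hn : 1 ≤ n then E n hn else ∅, hc0, hc, fun n hn => ?_⟩
  simp only [hn, dite_true]
  obtain ⟨hEm, hEσ, hlow, hup⟩ := hE n hn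
  refine ⟨hEm, hEσ, fun 𝒳 k f hf => ?_⟩
  have hlower : ∀ D D' : Fin k → 𝒳, PrivacyCLT.NeighboringAlong f (E n hn) D D' →
      ∀ α ∈ Icc (0 : ℝ) 1, PrivacyCLT.gaussianRoc 1 α - c n ≤
        PrivacyCLT.roc (PrivacyCLT.mechanism (φ n) f D) (PrivacyCLT.mechanism (φ n) f D') α := by
    intro D D' hD α hα
    obtain ⟨v, hv, hw⟩ := hD.exists_sub_eq_smul
    rw [PrivacyCLT.roc_mechanism, hw]
    exact hlow v hv _ ⟨norm_nonneg _, hf.1 ⟨D, D', hD.1, rfl⟩⟩ α hα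
  refine ⟨hlower, fun hfE α hα => ?_⟩
  set S := {β : ℝ | ∃ D D', PrivacyCLT.NeighboringAlong f (E n hn) D D' ∧
    β = PrivacyCLT.roc (PrivacyCLT.mechanism (φ n) f D) (PrivacyCLT.mechanism (φ n) f D') α}
  have hSlow : ∀ β ∈ S, PrivacyCLT.gaussianRoc 1 α - c n ≤ β := by
    rintro _ ⟨D, D', hD, rfl⟩
    exact hlower D D' hD α hα
  -- the supremum `1` need not be attained, so the upper bound uses differences of length near `1`
  have hclose : ∀ r : ℝ, 0 < r → ∃ D D', PrivacyCLT.NeighboringAlong f (E n hn) D D' ∧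
      1 - r < ‖f D' - f D‖ := by
    intro r hr
    obtain ⟨_, ⟨D, D', hD, rfl⟩, hlt, -⟩ := hfE.exists_between (sub_lt_self 1 hr)
    exact ⟨D, D', hD, hlt⟩
  have hSne : S.Nonempty := by
    obtain ⟨D, D', hD, -⟩ := hclose 1 one_pos
    exact ⟨_, D, D', hD, rfl⟩
  have h1 : PrivacyCLT.gaussianRoc 1 α - c n ≤ sInf S := le_csInf hSne hSlow
  have h2 : sInf S ≤ PrivacyCLT.gaussianRoc 1 α + c n := by
    refine le_of_forall_pos_le_add fun η hη => ?_
    obtain ⟨r, hr, hTV⟩ := (hφ n hn).exists_roc_smul_le hη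
    obtain ⟨D, D', hD, hlt⟩ := hclose r hr
    obtain ⟨v, hv, hw⟩ := hD.exists_sub_eq_smul
    have hle : ‖f D' - f D‖ ≤ 1 := hf.1 ⟨D, D', hD.1, rfl⟩
    have h3 : sInf S ≤ _ := csInf_le ⟨_, hSlow⟩ ⟨D, D', hD, rfl⟩
    have h4 := hTV v ‖f D' - f D‖ α (by simp) hα.1 (by rw [abs_lt]; constructor <;> linarith)
    rw [PrivacyCLT.roc_mechanism, hw] at h3
    linarith [hup v hv α hα]
  rw [PrivacyCLT.infRoc, abs_le]
  constructor <;> linarith
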